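/- Let $a\in u(n)$ be diagonal (for $a=\frac i2\,\mathrm{diag}(I_r,-I_{n-r})$ this is the case of the geometric and of the matrix non-linear Schrödinger equation). Let $u(n)_a$ be its centralizer in $u(n)$, $u(n)_a^\perp$ the orthogonal complement of $u(n)_a$ for $\langle y,z\rangle=-\mathrm{tr}(yz)$, and $M$ the adjoint $U(n)$-orbit of $a$. Let $\mathcal S(\mathbb R,u(n)_a^\perp)$ be the space of Schwartz maps, and $C_a(\mathbb R,M)$ the space of smooth paths $\gamma:\mathbb R\to M$ with $\gamma(-\infty)=a$ and $\gamma_x$ of Schwartz class; its tangent vectors at $\gamma$ are the velocities $\delta\gamma=\partial_s|_{s=0}\gamma_s$ of smooth curves $s\mapsto\gamma_s$ in $C_a(\mathbb R,M)$ with $\gamma_0=\gamma$. The development map $\Phi:C_a(\mathbb R,M)\to\mathcal S(\mathbb R,u(n)_a^\perp)$ is the inverse of $\Psi(u)=gag^{-1}$, where $g^{-1}g_x=u$ and $g(-\infty)=I$. Its differential is $d\Phi_\gamma(\delta\gamma)=\partial_s|_{s=0}\Phi(\gamma_s)$. Consider families of loops $\xi(x)(\lambda)=\sum_j\xi_j(x)\lambda^j$,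 convergent on a punctured neighbourhood of $\lambda=\infty$ that does not depend on $x$, with all $\xi_j:\mathbb R\to u(n)$ smooth and tending to $0$ as $x\to\pm\infty$. Let $\pi_{m,\infty}$ and $\pi_{-\infty,m}$ denote truncation to the powers $\lambda^j$ with $j\ge m$, respectively $j\le m$, and let $[\xi,d_x+A]=[\xi,A]-\xi_x$. Let $k$ be an integer. * Let $u\in\mathcal S(\mathbb R,u(n)_a^\perp)$. Say that $\xi$ generates $\delta u\in\mathcal S(\mathbb R,u(n)_a^\perp)$ to order $k$ at $u$ if either $k\le 0$, $\xi$ has only powers $\lambda^j$ with $j<0$, and $\delta u=\pi_{k,\infty}([\xi,d_x+a\lambda+u])$; or $k>0$, $\xi$ has only powers with $j\ge0$, and $\delta u=\pi_{-\infty,k-1}([d_x+a\lambda+u,\xi])$. Let $T_u^{(k)}$ be the set of $\delta u\in\mathcal S(\mathbb R,u(n)_a^\perp)$ that are generated both to order $0$ and to order $k$ (the vectors tangent at $d_x+a\lambda+u$ to the coadjoint orbits of order $0$ and $k$). The order-$k$ MNLS symplectic form is the orbit symplectic form on these vectors, $$(w_k)_u(\delta_1u,\delta_2u)=\int_{-\infty}^{\infty}\mathrm{tr}(\xi_{k-1}\,\delta_2u)\,dx,\qquad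 \xi\text{ generating }\delta_1u\text{ to order }k.$$ * Let $\gamma\in C_a(\mathbb R,M)$. Say that $\xi$ generates $\delta\gamma$ to order $k$ at $\gamma$ if either $k\le0$, $\xi$ has only powers $\lambda^j$ with $j\le0$, and $\delta\gamma\,\lambda=\pi_{k+1,\infty}([\xi,d_x+\gamma\lambda])$; or $k>0$, $\xi$ has only powers with $j>0$, and $\delta\gamma\,\lambda=\pi_{-\infty,k}([d_x+\gamma\lambda,\xi])$. Let $T_\gamma^{(k)}M$ be the set of tangent vectors of $C_a(\mathbb R,M)$ at $\gamma$ that are generated both to order $0$ and to order $k$. The order-$k$ GNLS symplectic form is the orbit symplectic form on these vectors, $$(\tau_k)_\gamma(\delta_1\gamma,\delta_2\gamma)=\int_{-\infty}^{\infty}\mathrm{tr}(\xi_k\,\delta_2\gamma)\,dx,\qquad \xi\text{ generating }\delta_1\gamma\text{ to order }k.$$ **Theorem.** For every integer $k$, $\Phi^*(w_k)=\tau_{k-2}$. In detail, for every $\gamma\in C_a(\mathbb R,M)$, with $u=\Phi(\gamma)$: 1. $d\Phi_\gamma$ exists: for every tangent vector $\delta\gamma$ of $C_a(\mathbb R,M)$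 at $\gamma$ and every smooth curve $\gamma_s$ in $C_a(\mathbb R,M)$ through $\gamma$ with velocity $\delta\gamma$, the derivative $\partial_s|_{s=0}\Phi(\gamma_s)(x)$ exists for each $x$ and depends only on $\delta\gamma$. 2. If $k\le 1$, then $d\Phi_\gamma$ maps $T^{(k-2)}_\gamma M$ into $T^{(k)}_u$. If $k\ge2$, then every tangent vector $\delta\gamma$ of $C_a(\mathbb R,M)$ at $\gamma$ with $d\Phi_\gamma(\delta\gamma)\in T^{(k)}_u$ lies in $T^{(k-2)}_\gamma M$. 3. If $\delta_1\gamma,\delta_2\gamma\in T_\gamma^{(k-2)}M$ and $d\Phi_\gamma(\delta_1\gamma),d\Phi_\gamma(\delta_2\gamma)\in T^{(k)}_u$, then $$(w_k)_u\big(d\Phi_\gamma(\delta_1\gamma),d\Phi_\gamma(\delta_2\gamma)\big)=(\tau_{k-2})_\gamma(\delta_1\gamma,\delta_2\gamma).$$ -/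

import Mathlib

open Filter Topology
open scoped ContDiff SchwartzMap Matrix.Norms.Frobenius

noncomputable section

namespace Development

/-- Complex `n × n` matrices, with the Frobenius norm. -/
abbrev Mat (n : ℕ) : Type := Matrix (Fin n) (Fin n) ℂ

/-! ### The Lie algebra `u(n)` and the adjoint orbit of `a` -/

/-- The Lie algebra `u(n)` of skew-Hermitian matrices. -/
def uLie (n : ℕ) : Set (Mat n) := {y | star y = -y}

/-- The centralizer `u(n)_a`. -/
def centr {n : ℕ} (a : Mat n) : Set (Mat n) := {y | y ∈ uLie n ∧ ⁅y, a⁆ = 0}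

/-- The orthogonal complement `u(n)_a^⊥` of `u(n)_a` in `u(n)`, for `⟨y, z⟩ = -tr (y z)`. -/
def centrPerp {n : ℕ} (a : Mat n) : Set (Mat n) :=
  {y | y ∈ uLie n ∧ ∀ z ∈ centr a, -Matrix.trace (y * z) = 0}

/-- The adjoint `U(n)`-orbit `M` at `a`. -/
def adjOrbit {n : ℕ} (a : Mat n) : Set (Mat n) :=
  {y | ∃ g ∈ Matrix.unitaryGroup (Fin n) ℂ, y = g * a * g⁻¹}

/-! ### The two phase spaces -/

/-- `f` is smooth and of Schwartz class. -/
def IsSchwartz {n : ℕ} (f : ℝ → Mat n) : Prop := ∃ F : 𝓢(ℝ, Mat n), ∀ x, F x = f x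

/-- The space `𝓢(ℝ, u(n)_a^⊥)`. -/
def schwartzPerp {n : ℕ} (a : Mat n) : Set (ℝ → Mat n) :=
  {u | IsSchwartz u ∧ ∀ x, u x ∈ centrPerp a}

/-- The space `C_a(ℝ, M)` of smooth paths `γ` in `M` with `γ(-∞) = a` and `γ_x` of Schwartz
class. -/
def pathSpace {n : ℕ} (a : Mat n) : Set (ℝ → Mat n) :=
  {γ | ContDiff ℝ ∞ γ ∧ (∀ x, γ x ∈ adjOrbit a) ∧ Tendsto γ atBot (𝓝 a) ∧ IsSchwartz (deriv γ)}

/-! ### The development map -/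

/-- `g` solves `g⁻¹ g_x = u`, `g(-∞) = I`. -/
def IsFrame {n : ℕ} (u g : ℝ → Mat n) : Prop :=
  (∀ x, HasDerivAt g (g x * u x) x) ∧ Tendsto g atBot (𝓝 1)

open Classical in
/-- The map `Ψ(u) = g a g⁻¹`, where `g⁻¹ g_x = u` and `g(-∞) = I`. -/
def Psi {n : ℕ} (a : Mat n) (u : ℝ → Mat n) : ℝ → Mat n :=
  if h : ∃ g, IsFrame u g then fun x => h.choose x * a * (h.choose x)⁻¹ else 0

/-- The development map `Φ`, the inverse of `Ψ : 𝓢(ℝ, u(n)_a^⊥) → C_a(ℝ, M)`. -/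
def Phi {n : ℕ} (a : Mat n) : (ℝ → Mat n) → (ℝ → Mat n) :=
  Function.invFunOn (Psi a) (schwartzPerp a)

/-! ### Tangent vectors and the differential of the development map -/

/-- `c` is a smooth curve `s ↦ c s` in `C_a(ℝ, M)`: it is jointly smooth in `(s, x)`, and
`s ↦ ∂ₓ(c s)` is a smooth curve in the Schwartz space (all `(s, x)`-derivatives of `∂ₓ c` are
rapidly decreasing in `x`, locally uniformly in `s`). -/
def IsSmoothCurve {n : ℕ} (a : Mat n) (c : ℝ → ℝ → Mat n) : Prop :=
  ContDiff ℝ ∞ (fun q : ℝ × ℝ => c q.1 q.2) ∧ (∀ s, c s ∈ pathSpace a) ∧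
    ∀ (p m : ℕ) (r : ℝ), ∃ C : ℝ, ∀ s ∈ Set.Icc (-r) r, ∀ x : ℝ,
      |x| ^ p * ‖iteratedFDeriv ℝ m (fun q : ℝ × ℝ => deriv (c q.1) q.2) (s, x)‖ ≤ C

/-- The variation `δ` is the derivative of the curve `c` at `s = 0`. -/
def HasVelocity {n : ℕ} (c : ℝ → ℝ → Mat n) (δ : ℝ → Mat n) : Prop :=
  ∀ x, HasDerivAt (fun s => c s x) (δ x) 0

/-- `c` is a smooth curve in `C_a(ℝ, M)` through `γ` with velocity `δ`. -/
def Represents {n : ℕ} (a : Mat n) (γ δ : ℝ → Mat n) (c : ℝ → ℝ → Mat n) : Prop :=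
  IsSmoothCurve a c ∧ c 0 = γ ∧ HasVelocity c δ

/-- The tangent space of `C_a(ℝ, M)` at `γ`. -/
def tangentPath {n : ℕ} (a : Mat n) (γ : ℝ → Mat n) : Set (ℝ → Mat n) :=
  {δ | ∃ c, Represents a γ δ c}

open Classical in
/-- The differential `dΦ_γ`: the derivative of `Φ` along a curve that represents `δ`. -/
def dPhi {n : ℕ} (a : Mat n) (γ δ : ℝ → Mat n) : ℝ → Mat n :=
  if h : ∃ c, Represents a γ δ c then fun x => deriv (fun s => Phi a (h.choose s) x) 0 else 0

/-! ### Loops -/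

/-- A loop `∑ A_j λ^j`, given by its Laurent coefficients. -/
abbrev Loop (n : ℕ) : Type := ℤ → Mat n

/-- `ξ` is a map from `ℝ` to the Lie algebra `𝒢` of holomorphic maps `A(λ)` on
`1/ε < |λ| < ∞` with the reality condition `A(λ̄)^* + A(λ) = 0` (that is, all Laurent coefficients
are in `u(n)`), smooth in `x` and decaying as `x → ±∞`; the powers of `λ` which
occur lie in `J`. -/
def IsDecayingLoop {n : ℕ} (J : Set ℤ) (ξ : ℝ → Loop n) : Prop :=
  (∃ ε : ℝ, 0 < ε ∧ ∀ x, ∀ r : ℝ, 1 / ε < r → Summable (fun j : ℤ => ‖ξ x j‖ * r ^ j)) ∧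
  (∀ x j, ξ x j ∈ uLie n) ∧
  (∀ x, ∀ j ∉ J, ξ x j = 0) ∧
  (∀ j, ContDiff ℝ ∞ (fun x => ξ x j)) ∧
  (∀ j, Tendsto (fun x => ξ x j) atTop (𝓝 0) ∧ Tendsto (fun x => ξ x j) atBot (𝓝 0))

/-- The bilinear form `∑_i tr (A_i B_{m-i})`: it is `⟨A, B⟩ = ∮ tr (A B) dλ` for `m = -1`, and the
form `(A, B)` used for paths in `M` for `m = 1`. -/
def loopForm {n : ℕ} (m : ℤ) (A B : Loop n) : ℂ := ∑ᶠ i : ℤ, Matrix.trace (A i * B (m - i))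

/-- The Casimir operator `Λ_k(A)(λ) = λ^{-k} A(λ)`. -/
def casimir {n : ℕ} (k : ℤ) (A : Loop n) : Loop n := fun j => A (j + k)

/-- The projection `∑ A_j λ^j ↦ ∑_{j ≥ m} A_j λ^j`. -/
def projGE {n : ℕ} (m : ℤ) (A : Loop n) : Loop n := fun j => if m ≤ j then A j else 0

/-- The projection `∑ A_j λ^j ↦ ∑_{j ≤ m} A_j λ^j`. -/
def projLE {n : ℕ} (m : ℤ) (A : Loop n) : Loop n := fun j => if j ≤ m then A j else 0

/-- The commutator `[ξ, d_x + A] = [ξ, A] - ξ_x` at `x`, as a loop. -/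
def bracketConn {n : ℕ} (ξ A : ℝ → Loop n) (x : ℝ) : Loop n :=
  fun j => (∑ᶠ i : ℤ, ⁅ξ x i, A x (j - i)⁆) - deriv (fun y => ξ y j) x

/-! ### The symplectic forms `w_k` -/

/-- The loop `a λ + u`. -/
def connU {n : ℕ} (a : Mat n) (u : ℝ → Mat n) (x : ℝ) : Loop n :=
  fun j => if j = 1 then a else if j = 0 then u x else 0

/-- `ξ` generates the variation `δ` of `d_x + a λ + u` under the coadjoint action which belongs to
the form `⟨ , ⟩_{Λ_k}`.
For `k ≤ 0`: `ξ ∈ C_s(ℝ, 𝒢_-)` and `δ = π_{k,∞} [ξ, d_x + a λ + u]`.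
For `k > 0`: `ξ ∈ C_s(ℝ, 𝒢_+)` and `δ = π_{-∞,k-1} [d_x + a λ + u, ξ]`. -/
def GeneratesU {n : ℕ} (a : Mat n) (k : ℤ) (u δ : ℝ → Mat n) (ξ : ℝ → Loop n) : Prop :=
  (k ≤ 0 ∧ IsDecayingLoop {j | j < 0} ξ ∧
    ∀ x, Pi.single 0 (δ x) = projGE k (bracketConn ξ (connU a u) x)) ∨
  (0 < k ∧ IsDecayingLoop {j | 0 ≤ j} ξ ∧
    ∀ x, Pi.single 0 (δ x) = projLE (k - 1) (-bracketConn ξ (connU a u) x))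

/-- The vectors `δ ∈ 𝓢(ℝ, u(n)_a^⊥)` that are tangent at `u` to the coadjoint orbits of order `0`
and of order `k`. -/
def tangentU {n : ℕ} (a : Mat n) (k : ℤ) (u : ℝ → Mat n) : Set (ℝ → Mat n) :=
  {δ | δ ∈ schwartzPerp a ∧ (∃ ξ, GeneratesU a 0 u δ ξ) ∧ ∃ ξ, GeneratesU a k u δ ξ}

open Classical in
/-- The form `w_k`, the restriction of the orbit symplectic form
`(δ₁, δ₂) ↦ ⟪ξ, δ₂⟫_{Λ_k}`, where `ξ` generates `δ₁`. -/
def wForm {n : ℕ} (a : Mat n) (k : ℤ) (u δ₁ δ₂ : ℝ → Mat n) : ℂ :=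
  if h : ∃ ξ, GeneratesU a k u δ₁ ξ then
    ∫ x, loopForm (-1) (casimir k (h.choose x)) (Pi.single 0 (δ₂ x)) else 0

/-! ### The symplectic forms `τ_k` -/

/-- The loop `γ λ`. -/
def connPath {n : ℕ} (γ : ℝ → Mat n) (x : ℝ) : Loop n := Pi.single 1 (γ x)

/-- `ξ` generates the variation `δ λ` of `d_x + γ λ` under the coadjoint action which belongs to the
form `( , )_{Λ_k}`.
For `k ≤ 0`: `ξ ∈ C_s(ℝ, 𝒢_{≤0})` and `δ λ = π_{k+1,∞} [ξ, d_x + γ λ]`.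
For `k > 0`: `ξ ∈ C_s(ℝ, 𝒢_{>0})` and `δ λ = π_{-∞,k} [d_x + γ λ, ξ]`. -/
def GeneratesPath {n : ℕ} (k : ℤ) (γ δ : ℝ → Mat n) (ξ : ℝ → Loop n) : Prop :=
  (k ≤ 0 ∧ IsDecayingLoop {j | j ≤ 0} ξ ∧
    ∀ x, Pi.single 1 (δ x) = projGE (k + 1) (bracketConn ξ (connPath γ) x)) ∨
  (0 < k ∧ IsDecayingLoop {j | 0 < j} ξ ∧
    ∀ x, Pi.single 1 (δ x) = projLE k (-bracketConn ξ (connPath γ) x))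

/-- The vectors tangent at `γ` to `C_a(ℝ, M)` and to the coadjoint orbits of order `0` and of
order `k`. -/
def tangentM {n : ℕ} (a : Mat n) (k : ℤ) (γ : ℝ → Mat n) : Set (ℝ → Mat n) :=
  {δ | δ ∈ tangentPath a γ ∧ (∃ ξ, GeneratesPath 0 γ δ ξ) ∧ ∃ ξ, GeneratesPath k γ δ ξ}

open Classical in
/-- The form `τ_k`, the restriction of the orbit symplectic form
`(δ₁, δ₂) ↦ ((ξ, δ₂ λ))_{Λ_k}`, where `ξ` generates `δ₁`. -/
def tauForm {n : ℕ} (k : ℤ) (γ δ₁ δ₂ : ℝ → Mat n) : ℂ :=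
  if h : ∃ ξ, GeneratesPath k γ δ₁ ξ then
    ∫ x, loopForm 1 (casimir k (h.choose x)) (Pi.single 1 (δ₂ x)) else 0

end Development

end

/-! The development map is a gauge transformation. For `γ` in the path space there is a unique `v`
with `[v, γ] = γ_x` that is orthogonal to the centralizer of `γ`. It is a polynomial expression in
`γ`, linear in `γ_x` (`adInv`), hence of Schwartz class. The solution of `g_x = v g`, `g(-∞) = 1` is
unitary, satisfies `γ = g a g⁻¹`, and gives `Φ(γ) = u = g⁻¹ v g = g⁻¹ g_x` (`path_eq_conj`,
`Phi_eq`). Conjugation by `g` therefore takes `d_x + γ λ` to `d_x + a λ + u`.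

Along a curve of paths put `η = g⁻¹ δg`. Duhamel's formula and dominated convergence show that it
exists (`hasDerivAt_frame`). It is bounded, vanishes at `-∞`, and satisfies `δγ = g [η, a] g⁻¹` and
`Dη = δu`, where `D = d_x + ad u`. These facts are collected in `IsVariation`.

If `ξ` generates `δγ`, then `ζ = g⁻¹ ξ g` satisfies the recursion `Dζ_j = [ζ_{j-1}, a]` in a range
of powers; a loop `χ` generating `δu` satisfies the same recursion in another range. Two uniqueness
principles match them: a solution of `Dκ = 0` that vanishes at `-∞` is zero (`eq_zero_of_parallel`),
and so is a `κ` in the centralizer of `a` that vanishes at `-∞` and has `Dκ` off-diagonal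
(`eq_zero_of_commute`). They give `ζ_0 = η` or `χ_0 = η`, the transport of generators behind the
comparison of tangent spaces, and a field `β` that decays at both ends, with `Dβ = [ζ_{k-2}, a]` and
`β - χ_{k-1}` in the centralizer of `a` (`exists_comparison`).

The equality of the forms is then one integration by parts. As `δ₂u` is off-diagonal, `tr(χ_{k-1}
δ₂u) = tr(β Dη₂)`, whereas `tr(ξ_{k-2} δ₂γ) = tr(ζ_{k-2} [η₂, a]) = -tr(Dβ η₂)`. The difference is
the derivative of `tr(β η₂)`, which vanishes at both ends (`integral_trace_eq`). -/

namespace Development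

open MeasureTheory Set

/-! ### Linear differential equations with initial value at `-∞` -/

section LinearODE

variable {E : Type*} [NormedAddCommGroup E] [NormedSpace ℝ E]

theorem hasDerivAt_integral_Iic [CompleteSpace E] {f : ℝ → E} (hc : Continuous f)
    (hi : Integrable f) (x : ℝ) :
    HasDerivAt (fun x => ∫ y in Iic x, f y) (f x) x := by
  have h : (fun x => ∫ y in Iic x, f y) =
      fun x => (∫ y in (0 : ℝ)..x, f y) + ∫ y in Iic 0, f y := by
    ext z
    rw [← intervalIntegral.integral_Iic_sub_Iic hi.integrableOn hi.integrableOn]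
    abel
  rw [h]
  exact (intervalIntegral.integral_hasDerivAt_right (hc.intervalIntegrable _ _)
    (hc.stronglyMeasurableAtFilter _ _) hc.continuousAt).add_const _

theorem tendsto_integral_Iic (f : ℝ → E) :
    Tendsto (fun x => ∫ y in Iic x, f y) atBot (𝓝 0) :=
  tendsto_integral_Iic_zero tendsto_id

theorem integral_Iic_eq_of_hasDerivAt [CompleteSpace E] {f f' : ℝ → E} {m : E}
    (h : ∀ x, HasDerivAt f (f' x) x)
    (hi : Integrable f') (hm : Tendsto f atBot (𝓝 m)) (x : ℝ) :
    ∫ y in Iic x, f' y = f x - m :=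
  integral_Iic_of_hasDerivAt_of_tendsto (h x).continuousAt.continuousWithinAt
    (fun y _ => h y) hi.integrableOn hm

theorem norm_integral_Iic_le {f : ℝ → E} {w : ℝ → ℝ} (hw : Integrable w)
    (h : ∀ x, ‖f x‖ ≤ w x) (x : ℝ) : ‖∫ y in Iic x, f y‖ ≤ ∫ y in Iic x, w y :=
  norm_integral_le_of_norm_le hw.integrableOn (Eventually.of_forall h)

theorem integral_Iic_le {w : ℝ → ℝ} (hw : Integrable w) (h : ∀ x, 0 ≤ w x) (x : ℝ) :
    ∫ y in Iic x, w y ≤ ∫ y, w y :=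
  setIntegral_le_integral hw (Eventually.of_forall h)

theorem eq_of_hasDerivAt_zero {f : ℝ → E} {m : E} (h : ∀ x, HasDerivAt f 0 x) {l : Filter ℝ}
    [l.NeBot] (hm : Tendsto f l (𝓝 m)) (x : ℝ) : f x = m := by
  have hc : ∀ y, f y = f x := fun y =>
    is_const_of_deriv_eq_zero (fun z => (h z).differentiableAt) (fun z => (h z).deriv) y x
  have : Tendsto f l (𝓝 (f x)) := by
    rw [funext hc]
    exact tendsto_const_nhds
  exact tendsto_nhds_unique this hm

variable {A : Type*} [NormedRing A] [NormedAlgebra ℝ A] [CompleteSpace A]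

/-- The iterated integrals of the Peano-Baker series. -/
noncomputable def peanoBaker (v : ℝ → A) : ℕ → ℝ → A
  | 0 => fun _ => 1
  | k + 1 => fun x => ∫ y in Iic x, v y * peanoBaker v k y

/-- With `W' = ‖v‖`, the function `W ^ (k + 1) / (k + 1)!` is the primitive of `‖v‖ W ^ k / k!` that
vanishes at `-∞`. The factorial makes the series converge uniformly on the whole line. -/
theorem peanoBaker_bound {v : ℝ → A} (hc : Continuous v) (hi : Integrable v) (k : ℕ) :
    Continuous (peanoBaker v k) ∧
      ∀ x, ‖peanoBaker v k x‖ ≤ ‖(1 : A)‖ * ((∫ y in Iic x, ‖v y‖) ^ k / k.factorial) := by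
  set W : ℝ → ℝ := fun x => ∫ y in Iic x, ‖v y‖ with hW
  have hWd : ∀ x, HasDerivAt W (‖v x‖) x := hasDerivAt_integral_Iic hc.norm hi.norm
  have hWc : Continuous W := continuous_iff_continuousAt.2 fun x => (hWd x).continuousAt
  have hW0 : ∀ x, 0 ≤ W x := fun x => integral_nonneg fun y => norm_nonneg _
  have hW1 : ∀ x, W x ≤ ∫ y, ‖v y‖ := integral_Iic_le hi.norm fun y => norm_nonneg _
  induction k with
  | zero => exact ⟨continuous_const, fun x => by simp [peanoBaker]⟩
  | succ k ih =>
    obtain ⟨hcont, hb⟩ := ih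
    have hfac : ∀ x, ‖v x‖ * (‖(1 : A)‖ * (W x ^ k / k.factorial)) ≤
        ‖v x‖ * (‖(1 : A)‖ * ((∫ y, ‖v y‖) ^ k / k.factorial)) := fun x => by
      have := hW0 x
      gcongr
      exact hW1 x
    have hmajc : Continuous fun x => ‖v x‖ * (‖(1 : A)‖ * (W x ^ k / k.factorial)) := by fun_prop
    have hmaj : Integrable fun x => ‖v x‖ * (‖(1 : A)‖ * (W x ^ k / k.factorial)) :=
      Integrable.mono' (hi.norm.mul_const _) hmajc.aestronglyMeasurable
        (Eventually.of_forall fun x => by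
          rw [Real.norm_of_nonneg]
          · exact hfac x
          · have := hW0 x; positivity)
    have hle : ∀ x, ‖v x * peanoBaker v k x‖ ≤ ‖v x‖ * (‖(1 : A)‖ * (W x ^ k / k.factorial)) :=
      fun x => (norm_mul_le _ _).trans (mul_le_mul_of_nonneg_left (hb x) (norm_nonneg _))
    have hint : Integrable fun x => v x * peanoBaker v k x :=
      Integrable.mono' hmaj (hc.mul hcont).aestronglyMeasurable (Eventually.of_forall hle)
    refine ⟨continuous_iff_continuousAt.2 fun x =>
      (hasDerivAt_integral_Iic (hc.mul hcont) hint x).continuousAt, fun x => ?_⟩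
    refine (norm_integral_Iic_le hmaj hle x).trans (le_of_eq ?_)
    have hpow : ∀ x, HasDerivAt (fun x => ‖(1 : A)‖ * (W x ^ (k + 1) / (k + 1).factorial))
        (‖v x‖ * (‖(1 : A)‖ * (W x ^ k / k.factorial))) x := fun x => by
      refine ((((hWd x).pow (k + 1)).div_const ((k + 1).factorial : ℝ)).const_mul
        ‖(1 : A)‖).congr_deriv ?_
      have : (k.factorial : ℝ) ≠ 0 := by positivity
      simp only [Nat.factorial_succ, Nat.cast_mul, Nat.cast_succ, Nat.add_sub_cancel]
      field_simp
    have hlim : Tendsto (fun x => ‖(1 : A)‖ * (W x ^ (k + 1) / (k + 1).factorial)) atBot (𝓝 0) := by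
      have := (((tendsto_integral_Iic fun y => ‖v y‖).pow (k + 1)).div_const
        ((k + 1).factorial : ℝ)).const_mul ‖(1 : A)‖
      simpa using this
    rw [integral_Iic_eq_of_hasDerivAt hpow hmaj hlim, sub_zero]

/-- A linear equation `g_x = v g` with bounded integrable coefficient has a bounded solution with
`g(-∞) = 1`. -/
theorem exists_linear_solution {v : ℝ → A} (hc : Continuous v) (hi : Integrable v) {C : ℝ}
    (hC : ∀ x, ‖v x‖ ≤ C) :
    ∃ g : ℝ → A, (∀ x, HasDerivAt g (v x * g x) x) ∧ Tendsto g atBot (𝓝 1) ∧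
      ∃ K, ∀ x, ‖g x‖ ≤ K := by
  set I : ℝ := ∫ y, ‖v y‖
  have hI : 0 ≤ I := integral_nonneg fun y => norm_nonneg _
  have hC0 : 0 ≤ C := (norm_nonneg _).trans (hC 0)
  have hsum : Summable fun k : ℕ => ‖(1 : A)‖ * (I ^ k / k.factorial) :=
    (Real.summable_pow_div_factorial I).mul_left _
  have hW0 : ∀ x, 0 ≤ ∫ y in Iic x, ‖v y‖ := fun x => integral_nonneg fun y => norm_nonneg _
  have hb : ∀ k x, ‖peanoBaker v k x‖ ≤ ‖(1 : A)‖ * (I ^ k / k.factorial) := fun k x => by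
    refine ((peanoBaker_bound hc hi k).2 x).trans ?_
    have := hW0 x
    gcongr
    exact integral_Iic_le hi.norm (fun y => norm_nonneg _) x
  have hcont : ∀ k, Continuous (peanoBaker v k) := fun k => (peanoBaker_bound hc hi k).1
  have hsummable : ∀ x, Summable fun k => peanoBaker v k x := fun x =>
    Summable.of_norm_bounded hsum fun k => hb k x
  -- The derivative of term `k + 1` is `v` times term `k`, so the differentiated series is the
  -- original one shifted by one and multiplied by `v`; `b` is its majorant.
  let g' : ℕ → ℝ → A := fun k => Nat.casesOn k (fun _ => 0) fun k x => v x * peanoBaker v k x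
  let b : ℕ → ℝ := fun k => Nat.casesOn k 0 fun k => C * (‖(1 : A)‖ * (I ^ k / k.factorial))
  have hbsum : Summable b := (summable_nat_add_iff 1).1 (hsum.mul_left C)
  have hle : ∀ k x, ‖v x * peanoBaker v k x‖ ≤ ‖v x‖ * (‖(1 : A)‖ * (I ^ k / k.factorial)) :=
    fun k x => (norm_mul_le _ _).trans (mul_le_mul_of_nonneg_left (hb k x) (norm_nonneg _))
  have hder : ∀ k x, HasDerivAt (peanoBaker v k) (g' k x) x := by
    rintro (_ | k) x
    · exact hasDerivAt_const x 1
    · refine hasDerivAt_integral_Iic (hc.mul (hcont k)) ?_ x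
      exact Integrable.mono' (hi.norm.mul_const _) (hc.mul (hcont k)).aestronglyMeasurable
        (Eventually.of_forall (hle k))
  have hg'b : ∀ k x, ‖g' k x‖ ≤ b k := by
    rintro (_ | k) x
    · simp [g', b]
    · refine (hle k x).trans (mul_le_mul_of_nonneg_right (hC x) ?_)
      positivity
  refine ⟨fun x => ∑' k, peanoBaker v k x, fun x => ?_, ?_, ?_⟩
  · refine (hasDerivAt_tsum hbsum hder hg'b (hsummable 0) x).congr_deriv ?_
    have hs' : Summable fun k => g' k x := Summable.of_norm_bounded hbsum fun k => hg'b k x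
    rw [hs'.tsum_eq_zero_add]
    exact (zero_add _).trans ((hsummable x).tsum_mul_left (v x))
  · have hlim : ∀ k, Tendsto (peanoBaker v k) atBot (𝓝 (if k = 0 then (1 : A) else 0)) := by
      rintro (_ | k)
      · simp [peanoBaker]
      · simp only [Nat.add_eq_zero_iff, one_ne_zero, and_false, if_false]
        exact tendsto_integral_Iic _
    have := tendsto_tsum_of_dominated_convergence hsum hlim
      (Eventually.of_forall fun x k => hb k x)
    simpa using this
  · exact ⟨_, fun x => tsum_of_norm_bounded hsum.hasSum fun k => hb k x⟩

end LinearODE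

/-! ### Rapidly decreasing functions and functions of temperate growth -/

section Rapid

variable {E F : Type*} [NormedAddCommGroup E] [NormedSpace ℝ E] [NormedAddCommGroup F]
  [NormedSpace ℝ F]

/-- `f` is a Schwartz function. -/
def IsRapid (f : ℝ → E) : Prop := ∃ φ : 𝓢(ℝ, E), ∀ x, φ x = f x

theorem IsRapid.of_bounds {f : ℝ → E} (hf : ContDiff ℝ ∞ f)
    (hb : ∀ p m : ℕ, ∃ C : ℝ, ∀ x : ℝ, |x| ^ p * ‖iteratedFDeriv ℝ m f x‖ ≤ C) : IsRapid f :=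
  ⟨⟨f, hf, hb⟩, fun _ => rfl⟩

theorem IsRapid.contDiff {f : ℝ → E} (hf : IsRapid f) : ContDiff ℝ ∞ f := by
  obtain ⟨φ, hφ⟩ := hf
  rw [← funext hφ]
  exact φ.smooth ⊤

theorem IsRapid.continuous {f : ℝ → E} (hf : IsRapid f) : Continuous f := hf.contDiff.continuous

theorem IsRapid.decay {f : ℝ → E} (hf : IsRapid f) (p m : ℕ) :
    ∃ C : ℝ, ∀ x : ℝ, |x| ^ p * ‖iteratedFDeriv ℝ m f x‖ ≤ C := by
  obtain ⟨φ, hφ⟩ := hf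
  rw [← funext hφ]
  exact φ.decay' p m

theorem IsRapid.integrable {f : ℝ → E} (hf : IsRapid f) : Integrable f := by
  obtain ⟨φ, hφ⟩ := hf
  rw [← funext hφ]
  exact φ.integrable

theorem IsRapid.temperate {f : ℝ → E} (hf : IsRapid f) : f.HasTemperateGrowth := by
  obtain ⟨φ, hφ⟩ := hf
  rw [← funext hφ]
  exact φ.hasTemperateGrowth

theorem IsRapid.bounded {f : ℝ → E} (hf : IsRapid f) : ∃ C, ∀ x, ‖f x‖ ≤ C := by
  obtain ⟨C, hC⟩ := hf.decay 0 0
  exact ⟨C, fun x => by simpa using hC x⟩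

theorem IsRapid.add {f g : ℝ → E} (hf : IsRapid f) (hg : IsRapid g) :
    IsRapid fun x => f x + g x := by
  obtain ⟨φ, hφ⟩ := hf
  obtain ⟨ψ, hψ⟩ := hg
  exact ⟨φ + ψ, fun x => by simp [hφ, hψ]⟩

theorem IsRapid.clm {f : ℝ → E} (hf : IsRapid f) (L : E →L[ℝ] F) : IsRapid fun x => L (f x) := by
  obtain ⟨φ, hφ⟩ := hf
  exact ⟨SchwartzMap.postcompCLM L φ, fun x => by simp [hφ]⟩

theorem IsRapid.neg {f : ℝ → E} (hf : IsRapid f) : IsRapid fun x => -f x :=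
  hf.clm (-ContinuousLinearMap.id ℝ E)

theorem IsRapid.sub {f g : ℝ → E} (hf : IsRapid f) (hg : IsRapid g) :
    IsRapid fun x => f x - g x := by
  simpa only [sub_eq_add_neg] using hf.add hg.neg

theorem IsRapid.bilin {G : Type*} [NormedAddCommGroup G] [NormedSpace ℝ G] (B : E →L[ℝ] F →L[ℝ] G)
    {f : ℝ → E} {g : ℝ → F} (hf : IsRapid f) (hg : g.HasTemperateGrowth) :
    IsRapid fun x => B (f x) (g x) := by
  obtain ⟨φ, hφ⟩ := hf
  exact ⟨SchwartzMap.bilinLeftCLM B hg φ, fun x => by simp [hφ]⟩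

theorem IsRapid.clm_apply {f : ℝ → E} {g : ℝ → E →L[ℝ] F} (hg : g.HasTemperateGrowth)
    (hf : IsRapid f) : IsRapid fun x => g x (f x) :=
  hf.bilin (ContinuousLinearMap.apply ℝ F : E →L[ℝ] (E →L[ℝ] F) →L[ℝ] F) hg

theorem temperate_of_hasDerivAt {f f' : ℝ → E} (h : ∀ x, HasDerivAt f (f' x) x)
    (hf' : f'.HasTemperateGrowth) {C : ℝ} (hC : ∀ x, ‖f x‖ ≤ C) : f.HasTemperateGrowth := by
  refine Function.HasTemperateGrowth.of_fderiv (k := 0) (C := C) ?_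
    (fun x => (h x).differentiableAt) (by simpa using hC)
  have : fderiv ℝ f = ContinuousLinearMap.smulRightL ℝ ℝ E (1 : ℝ →L[ℝ] ℝ) ∘ f' := by
    ext1 x
    refine (h x).hasFDerivAt.fderiv.trans ?_
    ext
    simp
  rw [this]
  exact (ContinuousLinearMap.hasTemperateGrowth _).comp hf'

/-- Expand `(1 + x²)² = 1 + 2x² + x⁴`. The two factors are kept apart because one will be integrated
while the other survives as decay. -/
theorem IsRapid.exists_bound {f : ℝ → E} (hf : IsRapid f) :
    ∃ C, 0 ≤ C ∧ ∀ x, ‖f x‖ ≤ C * ((1 + x ^ 2)⁻¹ * (1 + x ^ 2)⁻¹) := by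
  obtain ⟨C₀, h₀⟩ := hf.decay 0 0
  obtain ⟨C₂, h₂⟩ := hf.decay 2 0
  obtain ⟨C₄, h₄⟩ := hf.decay 4 0
  simp only [pow_zero, one_mul, norm_iteratedFDeriv_zero] at h₀ h₂ h₄
  have e₄ : ∀ x : ℝ, |x| ^ 4 = x ^ 4 := fun x => by
    rw [← abs_pow, abs_of_nonneg (by positivity)]
  simp only [sq_abs, e₄] at h₂ h₄
  have key : ∀ x, ‖f x‖ * ((1 + x ^ 2) * (1 + x ^ 2)) ≤ C₀ + 2 * C₂ + C₄ := fun x => by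
    nlinarith [h₀ x, h₂ x, h₄ x]
  refine ⟨C₀ + 2 * C₂ + C₄, le_trans (by positivity) (key 0), fun x => ?_⟩
  rw [← mul_inv, ← div_eq_mul_inv, le_div_iff₀ (by positivity)]
  exact key x

theorem norm_le_of_tendsto_atBot [CompleteSpace E] {f f' : ℝ → E}
    (h : ∀ x, HasDerivAt f (f' x) x)
    (hf' : Continuous f') {C : ℝ} (hb : ∀ x, ‖f' x‖ ≤ C * ((1 + x ^ 2)⁻¹ * (1 + x ^ 2)⁻¹))
    (hlim : Tendsto f atBot (𝓝 0)) {x : ℝ} (hx : x ≤ 0) :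
    ‖f x‖ ≤ C * Real.pi * (1 + x ^ 2)⁻¹ := by
  have hC : 0 ≤ C := by simpa using (norm_nonneg _).trans (hb 0)
  have hdom : ∀ y : ℝ, (1 + y ^ 2)⁻¹ ≤ 1 := fun y => inv_le_one_of_one_le₀ (by nlinarith)
  have hi : Integrable f' := by
    refine Integrable.mono' (integrable_inv_one_add_sq.const_mul C) hf'.aestronglyMeasurable
      (Eventually.of_forall fun y => (hb y).trans ?_)
    refine mul_le_mul_of_nonneg_left ?_ hC
    exact mul_le_of_le_one_left (by positivity) (hdom y)
  have hx' : ∫ y in Iic x, f' y = f x := by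
    rw [integral_Iic_eq_of_hasDerivAt h hi hlim, sub_zero]
  rw [← hx']
  have h1 : ‖∫ y in Iic x, f' y‖ ≤ ∫ y in Iic x, C * (1 + x ^ 2)⁻¹ * (1 + y ^ 2)⁻¹ := by
    refine norm_integral_le_of_norm_le (integrable_inv_one_add_sq.const_mul _).integrableOn ?_
    refine (ae_restrict_iff' measurableSet_Iic).2 (Eventually.of_forall fun y hy => ?_)
    refine (hb y).trans ?_
    rw [mul_assoc]
    have hy' : y ≤ x := hy
    have : (1 + y ^ 2)⁻¹ ≤ (1 + x ^ 2)⁻¹ := inv_anti₀ (by positivity) (by nlinarith)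
    gcongr
  refine h1.trans ((integral_Iic_le (integrable_inv_one_add_sq.const_mul _)
    (fun y => by positivity) x).trans (le_of_eq ?_))
  rw [integral_const_mul, integral_univ_inv_one_add_sq]
  ring

/-- A function which vanishes at `±∞` and has a Schwartz derivative is integrable. -/
theorem integrable_of_rapid_deriv [CompleteSpace E] {f f' : ℝ → E}
    (h : ∀ x, HasDerivAt f (f' x) x) (hf' : IsRapid f') (hbot : Tendsto f atBot (𝓝 0))
    (htop : Tendsto f atTop (𝓝 0)) : Integrable f := by
  obtain ⟨C, hC, hb⟩ := hf'.exists_bound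
  refine Integrable.mono' (integrable_inv_one_add_sq.const_mul (C * Real.pi))
    (continuous_iff_continuousAt.2 fun x => (h x).continuousAt).aestronglyMeasurable
    (Eventually.of_forall fun x => ?_)
  rcases le_total x 0 with hx | hx
  · exact norm_le_of_tendsto_atBot h hf'.continuous hb hbot hx
  -- The right half-line reduces to the left one by the reflection `x ↦ -x`.
  · have h' : ∀ y, HasDerivAt (fun y => f (-y)) (-f' (-y)) y := fun y => by
      simpa [Function.comp_def] using (h (-y)).scomp y (hasDerivAt_neg y)
    have := norm_le_of_tendsto_atBot (C := C) h' (hf'.continuous.comp continuous_neg).neg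
      (fun y => by simpa using hb (-y)) (htop.comp tendsto_neg_atBot_atTop)
      (neg_nonpos.2 hx)
    simpa using this

end Rapid

/-! ### Products of Schwartz and temperate functions in a normed algebra -/

section Ring

variable {A : Type*} [NormedRing A] [NormedAlgebra ℝ A]

theorem IsRapid.mul_temperate {f g : ℝ → A} (hf : IsRapid f) (hg : g.HasTemperateGrowth) :
    IsRapid fun x => f x * g x :=
  hf.bilin (ContinuousLinearMap.mul ℝ A) hg

theorem IsRapid.temperate_mul {f g : ℝ → A} (hf : IsRapid f) (hg : g.HasTemperateGrowth) :
    IsRapid fun x => g x * f x :=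
  hf.bilin (ContinuousLinearMap.mul ℝ A).flip hg

/-- A bounded solution of a linear equation with Schwartz coefficient has temperate growth. -/
theorem temperate_of_linear_solution {v g : ℝ → A} (hv : IsRapid v)
    (hg : ∀ x, HasDerivAt g (v x * g x) x) {K : ℝ} (hK : ∀ x, ‖g x‖ ≤ K) :
    g.HasTemperateGrowth := by
  have hderiv : deriv g = fun x => v x * g x := funext fun x => (hg x).deriv
  have hsmooth : ∀ m : ℕ, ContDiff ℝ m g := by
    intro m
    induction m with
    | zero =>
      exact contDiff_zero.2 (continuous_iff_continuousAt.2 fun x => (hg x).continuousAt)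
    | succ m ih =>
      rw [Nat.cast_succ]
      refine contDiff_succ_iff_deriv.2 ⟨fun x => (hg x).differentiableAt, by simp, ?_⟩
      rw [hderiv]
      exact (hv.contDiff.of_le (mod_cast le_top)).mul ih
  have hbound : ∀ m : ℕ, ∃ C, ∀ x, ‖iteratedFDeriv ℝ m g x‖ ≤ C := by
    intro m
    induction m using Nat.strong_induction_on with
    | _ m ih =>
      rcases m with _ | m
      · exact ⟨K, by simpa using hK⟩
      · have hv' : ∀ i, ∃ C, ∀ x, ‖iteratedFDeriv ℝ i v x‖ ≤ C := fun i => by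
          obtain ⟨C, hC⟩ := hv.decay 0 i
          exact ⟨C, by simpa using hC⟩
        choose c hc using hv'
        choose! d hd using ih
        -- By Leibniz, the derivative of order `m + 1` of `g`, which is the `m`-th derivative of `v
        -- g`, involves only derivatives of `g` of order at most `m`.
        refine ⟨∑ i ∈ Finset.range (m + 1), (m.choose i : ℝ) * c i * d (m - i), fun x => ?_⟩
        rw [norm_iteratedFDeriv_eq_norm_iteratedDeriv, iteratedDeriv_succ', hderiv,
          ← norm_iteratedFDeriv_eq_norm_iteratedDeriv]
        refine (norm_iteratedFDeriv_mul_le (N := m) (hv.contDiff.of_le (mod_cast le_top))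
          (hsmooth m) x le_rfl).trans (Finset.sum_le_sum fun i _ => ?_)
        have h1 := hc i x
        have h2 := hd (m - i) (by omega) x
        have h3 := (norm_nonneg _).trans h1
        gcongr
  refine ⟨contDiff_infty.2 hsmooth, fun m => ?_⟩
  obtain ⟨C, hC⟩ := hbound m
  exact ⟨0, C, by simpa using hC⟩

theorem temperate_star [StarRing A] [NormedStarGroup A] [StarModule ℝ A] {g : ℝ → A}
    (hg : g.HasTemperateGrowth) : (fun x => star (g x)).HasTemperateGrowth :=
  ((starL' ℝ : A ≃L[ℝ] A) : A →L[ℝ] A).hasTemperateGrowth.comp hg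

end Ring

/-! ### Unitary frames -/

section Frames

/-- The product `h g*` has derivative `h (u + u*) g* = 0` and tends to `1` at `-∞`. -/
theorem frame_unique {A : Type*} [NormedRing A] [NormedAlgebra ℝ A] [StarRing A]
    [NormedStarGroup A] [StarModule ℝ A] {u g h : ℝ → A} (hskew : ∀ x, star (u x) = -u x)
    (hg : ∀ x, HasDerivAt g (g x * u x) x) (hglim : Tendsto g atBot (𝓝 1))
    (hone : ∀ x, star (g x) * g x = 1) (hh : ∀ x, HasDerivAt h (h x * u x) x)
    (hhlim : Tendsto h atBot (𝓝 1)) (x : ℝ) : h x = g x := by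
  have h1 : h x * star (g x) = 1 := by
    refine eq_of_hasDerivAt_zero (f := fun x => h x * star (g x)) (l := atBot) (fun x => ?_) ?_ x
    · refine ((hh x).mul (hg x).star).congr_deriv ?_
      rw [star_mul, hskew]
      noncomm_ring
    · simpa using hhlim.mul hglim.star
  rw [← mul_one (h x), ← hone x, ← mul_assoc, h1, one_mul]

variable {A : Type*} [NormedRing A] [NormedAlgebra ℝ A] [StarRing A]
  [NormedStarGroup A] [StarModule ℝ A]

/-- `g` is a unitary solution of `g_x = v g`, `g(-∞) = 1`, of temperate growth. -/
structure IsUnitarySolution (v g : ℝ → A) : Prop where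
  deriv : ∀ x, HasDerivAt g (v x * g x) x
  lim : Tendsto g atBot (𝓝 1)
  star_mul_self : ∀ x, star (g x) * g x = 1
  mul_star_self : ∀ x, g x * star (g x) = 1
  temperate : g.HasTemperateGrowth

theorem exists_unitarySolution [CompleteSpace A] [IsDedekindFiniteMonoid A] {v : ℝ → A}
    (hv : IsRapid v)
    (hskew : ∀ x, star (v x) = -v x) : ∃ g, IsUnitarySolution v g := by
  obtain ⟨C, hC⟩ := hv.bounded
  obtain ⟨g, hg, hlim, K, hK⟩ := exists_linear_solution hv.continuous hv.integrable hC
  have hone : ∀ x, star (g x) * g x = 1 := by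
    refine eq_of_hasDerivAt_zero (l := atBot) (fun x => ?_) ?_
    · refine ((hg x).star.mul (hg x)).congr_deriv ?_
      rw [star_mul, hskew]
      noncomm_ring
    · simpa using hlim.star.mul hlim
  exact ⟨g, hg, hlim, hone, fun x => mul_eq_one_symm (hone x),
    temperate_of_linear_solution hv hg hK⟩

theorem IsUnitarySolution.unique {v g h : ℝ → A} (hg : IsUnitarySolution v g)
    (hskew : ∀ x, star (v x) = -v x) (hh : ∀ x, HasDerivAt h (v x * h x) x)
    (hlim : Tendsto h atBot (𝓝 1)) (x : ℝ) : h x = g x := by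
  have hone : star (g x) * h x = 1 := by
    refine eq_of_hasDerivAt_zero (f := fun x => star (g x) * h x) (l := atBot) (fun x => ?_) ?_ x
    · refine ((hg.deriv x).star.mul (hh x)).congr_deriv ?_
      rw [star_mul, hskew]
      noncomm_ring
    · simpa using hg.lim.star.mul hlim
  rw [← one_mul (h x), ← hg.mul_star_self x, mul_assoc, hone, mul_one]

/-- For `u` in the Schwartz class and skew-adjoint, `g⁻¹ g_x = u`, `g(-∞) = 1` has a unitary
solution. -/
theorem exists_unitary_frame [CompleteSpace A] [IsDedekindFiniteMonoid A] {u : ℝ → A}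
    (hu : IsRapid u)
    (hskew : ∀ x, star (u x) = -u x) :
    ∃ g : ℝ → A, (∀ x, HasDerivAt g (g x * u x) x) ∧ Tendsto g atBot (𝓝 1) ∧
      (∀ x, star (g x) * g x = 1) ∧ ∀ x, g x * star (g x) = 1 := by
  -- The adjoint turns `g_x = g u` into `h_x = -u h`.
  obtain ⟨h, hh⟩ := exists_unitarySolution hu.neg fun x => by simp [hskew]
  refine ⟨fun x => star (h x), fun x => ?_, by simpa using hh.lim.star, fun x => ?_, fun x => ?_⟩
  · refine (hh.deriv x).star.congr_deriv ?_
    rw [star_mul, star_neg, hskew, neg_neg]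
  · rw [star_star, hh.mul_star_self]
  · rw [star_star, hh.star_mul_self]

end Frames

/-! ### Dependence of the frame on a parameter -/

section Variation

theorem norm_mul_three_le {A : Type*} [NormedRing A] {x y z : A} {a b c : ℝ}
    (hx : ‖x‖ ≤ a) (hy : ‖y‖ ≤ b) (hz : ‖z‖ ≤ c) :
    ‖x * y * z‖ ≤ a * b * c := by
  have ha := (norm_nonneg _).trans hx
  have hb := (norm_nonneg _).trans hy
  exact (norm_mul_le _ _).trans (mul_le_mul ((norm_mul_le _ _).trans
    (mul_le_mul hx hy (norm_nonneg _) ha)) hz (norm_nonneg _) (by positivity))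

variable {A : Type*} [NormedRing A] [NormedAlgebra ℝ A] [CompleteSpace A] [StarRing A]
  [NormedStarGroup A] [StarModule ℝ A]

variable {v g : ℝ → ℝ → A} {K C : ℝ}

/-- Duhamel's formula: the derivative of `g_0* g_s` is `g_0* (v_s - v_0) g_s`, because `v_0` is
skew. -/
theorem frame_difference (hv : ∀ s x, star (v s x) = -v s x) (hvc : ∀ s, Continuous (v s))
    (hg : ∀ s, IsUnitarySolution (v s) (g s)) (hK : ∀ s x, ‖g s x‖ ≤ K)
    (hC : ∀ s ∈ Icc (-1 : ℝ) 1, ∀ x, ‖v s x - v 0 x‖ ≤ C * |s| * (1 + x ^ 2)⁻¹)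
    {s : ℝ} (hs : s ∈ Icc (-1 : ℝ) 1) (x : ℝ) :
    ∫ y in Iic x, star (g 0 y) * (v s y - v 0 y) * g s y = star (g 0 x) * g s x - 1 := by
  have hgc : ∀ s, Continuous (g s) := fun s =>
    continuous_iff_continuousAt.2 fun x => ((hg s).deriv x).continuousAt
  refine integral_Iic_eq_of_hasDerivAt (f := fun x => star (g 0 x) * g s x) (fun y => ?_) ?_ ?_ x
  · refine (((hg 0).deriv y).star.mul ((hg s).deriv y)).congr_deriv ?_
    rw [star_mul, hv]
    noncomm_ring
  · refine Integrable.mono' ((integrable_inv_one_add_sq.const_mul (C * |s|)).const_mul (K * K))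
      (((hgc 0).star.mul ((hvc s).sub (hvc 0))).mul (hgc s)).aestronglyMeasurable
      (Eventually.of_forall fun y => ?_)
    refine (norm_mul_three_le ((norm_star _).trans_le (hK 0 y)) (hC s hs y) (hK s y)).trans
      (le_of_eq ?_)
    ring
  · simpa using (hg 0).lim.star.mul (hg s).lim

/-- The derivative of the frame with respect to a parameter. -/
theorem hasDerivAt_frame (hv : ∀ s x, star (v s x) = -v s x) (hvc : ∀ s, Continuous (v s))
    (hg : ∀ s, IsUnitarySolution (v s) (g s)) (hK : ∀ s x, ‖g s x‖ ≤ K)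
    (hC : ∀ s ∈ Icc (-1 : ℝ) 1, ∀ x, ‖v s x - v 0 x‖ ≤ C * |s| * (1 + x ^ 2)⁻¹)
    {w : ℝ → A} (hw : ∀ x, HasDerivAt (fun s => v s x) (w x) 0) (x : ℝ) :
    HasDerivAt (fun s => g s x) (g 0 x * ∫ y in Iic x, star (g 0 y) * w y * g 0 y) 0 := by
  have hC0 : 0 ≤ C := by simpa using (norm_nonneg _).trans (hC 1 (by simp) 0)
  have hK0 : 0 ≤ K := (norm_nonneg _).trans (hK 0 0)
  have hgc : ∀ s, Continuous (g s) := fun s =>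
    continuous_iff_continuousAt.2 fun x => ((hg s).deriv x).continuousAt
  have hnear : ∀ᶠ s : ℝ in 𝓝 0, s ∈ Icc (-1 : ℝ) 1 := Icc_mem_nhds (by norm_num) (by norm_num)
  -- The limit under the integral sign needs continuity of the frame in `s`; Duhamel's formula
  -- yields a Lipschitz estimate at `s = 0`.
  have hcont : ∀ y, Tendsto (fun s => g s y) (𝓝 0) (𝓝 (g 0 y)) := by
    intro y
    have hbound : ∀ᶠ s : ℝ in 𝓝 0,
        ‖g s y - g 0 y‖ ≤ K * (K * C * K * Real.pi) * |s| := by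
      filter_upwards [hnear] with s hs
      have h1 : g s y - g 0 y = g 0 y * (star (g 0 y) * g s y - 1) := by
        rw [mul_sub, ← mul_assoc, (hg 0).mul_star_self, one_mul, mul_one]
      rw [h1, ← frame_difference hv hvc hg hK hC hs, mul_assoc K]
      refine (norm_mul_le _ _).trans (mul_le_mul (hK 0 y) ?_ (norm_nonneg _) hK0)
      refine (norm_integral_Iic_le (w := fun z => K * (C * |s|) * K * (1 + z ^ 2)⁻¹)
        (integrable_inv_one_add_sq.const_mul _) (fun z => ?_) y).trans
        ((integral_Iic_le (integrable_inv_one_add_sq.const_mul _) (fun z => by positivity) y).trans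
          (le_of_eq ?_))
      · refine (norm_mul_three_le ((norm_star _).trans_le (hK 0 z)) (hC s hs z) (hK s z)).trans
          (le_of_eq ?_)
        ring
      · rw [integral_const_mul, integral_univ_inv_one_add_sq]
        ring
    rw [tendsto_iff_norm_sub_tendsto_zero]
    refine squeeze_zero' (Eventually.of_forall fun s => norm_nonneg _) hbound ?_
    have : Continuous fun s : ℝ => K * (K * C * K * Real.pi) * |s| := by fun_prop
    simpa using this.tendsto 0
  have hmain : HasDerivAt (fun s => star (g 0 x) * g s x)
      (∫ y in Iic x, star (g 0 y) * w y * g 0 y) 0 := by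
    rw [hasDerivAt_iff_tendsto_slope]
    have heq : ∀ᶠ s in 𝓝[≠] (0 : ℝ),
        ∫ y in Iic x, star (g 0 y) * (s⁻¹ • (v s y - v 0 y)) * g s y =
          slope (fun s => star (g 0 x) * g s x) 0 s := by
      filter_upwards [nhdsWithin_le_nhds hnear] with s hs
      rw [slope_def_module, (hg 0).star_mul_self, ← frame_difference hv hvc hg hK hC hs, sub_zero,
        ← integral_smul]
      simp only [mul_smul_comm, smul_mul_assoc]
    refine Tendsto.congr' heq ?_
    refine tendsto_integral_filter_of_dominated_convergence
      (fun y => K * C * K * (1 + y ^ 2)⁻¹) ?_ ?_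
      (integrable_inv_one_add_sq.const_mul _).integrableOn ?_
    · exact Eventually.of_forall fun s => (((hgc 0).star.mul
        (((hvc s).sub (hvc 0)).const_smul s⁻¹)).mul (hgc s)).aestronglyMeasurable
    · filter_upwards [nhdsWithin_le_nhds hnear, self_mem_nhdsWithin] with s hs hs0
      refine Eventually.of_forall fun y => ?_
      have hsm : ‖s⁻¹ • (v s y - v 0 y)‖ ≤ C * (1 + y ^ 2)⁻¹ := by
        have hspos : 0 < |s| := abs_pos.2 hs0
        rw [norm_smul, norm_inv, Real.norm_eq_abs, inv_mul_le_iff₀ hspos]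
        exact (hC s hs y).trans (le_of_eq (by ring))
      refine (norm_mul_three_le ((norm_star _).trans_le (hK 0 y)) hsm (hK s y)).trans
        (le_of_eq ?_)
      ring
    · refine Eventually.of_forall fun y => ?_
      have hs := hasDerivAt_iff_tendsto_slope.1 (hw y)
      have hs' : Tendsto (fun s : ℝ => s⁻¹ • (v s y - v 0 y)) (𝓝[≠] 0) (𝓝 (w y)) := by
        refine hs.congr fun s => ?_
        rw [slope_def_module, sub_zero]
      exact (hs'.const_mul _).mul ((hcont y).mono_left nhdsWithin_le_nhds)
  refine (hmain.const_mul (g 0 x)).congr_of_eventuallyEq (Eventually.of_forall fun s => ?_)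
  simp only
  rw [← mul_assoc, (hg 0).mul_star_self, one_mul]

end Variation

/-! ### Polynomials in elements of a normed algebra -/

section Algebra

open Polynomial

variable {A : Type*} [NormedRing A] [NormedAlgebra ℝ A] [Algebra ℂ A]

theorem temperate_aeval (p : ℂ[X]) : (fun y : A => aeval y p).HasTemperateGrowth := by
  induction p using Polynomial.induction_on' with
  | add p q hp hq =>
    simp only [map_add]
    exact hp.fun_add hq
  | monomial m c =>
    simp only [aeval_monomial]
    exact (Function.HasTemperateGrowth.const (algebraMap ℂ A c)).fun_mul
      (Function.HasTemperateGrowth.id'.fun_pow m)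

theorem aeval_conj {A : Type*} [Ring A] [Algebra ℂ A] {g g' y : A} (h₁ : g' * g = 1)
    (h₂ : g * g' = 1) (p : ℂ[X]) :
    aeval (g * y * g') p = g * aeval y p * g' := by
  induction p using Polynomial.induction_on' with
  | add p q hp hq => simp only [map_add, hp, hq, mul_add, add_mul]
  | monomial m c =>
    have hpow : (g * y * g') ^ m = g * y ^ m * g' := by
      induction m with
      | zero => simp [h₂]
      | succ m ih =>
        rw [pow_succ, ih, pow_succ]
        calc g * y ^ m * g' * (g * y * g') = g * y ^ m * (g' * g) * y * g' := by noncomm_ring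
          _ = g * (y ^ m * y) * g' := by rw [h₁]; noncomm_ring
    rw [aeval_monomial, aeval_monomial, hpow, ← mul_assoc, ← mul_assoc, Algebra.commutes c g]
    noncomm_ring

/-- If `p(γ) (γ - μ) = 0` along a path, then `p(γ) γ_x p(γ) = 0`. -/
theorem aeval_mul_deriv_mul_aeval {p : ℂ[X]} {μ : ℂ} {γ : ℝ → A} {w : A} {x : ℝ}
    (hp : ∀ x, aeval (γ x) (p * (X - C μ)) = 0) (hγ : HasDerivAt γ w x) :
    aeval (γ x) p * w * aeval (γ x) p = 0 := by
  have hdiff : DifferentiableAt ℝ (fun x => aeval (γ x) p) x :=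
    (((temperate_aeval (A := A) p).1.differentiable (by simp)) (γ x)).comp x hγ.differentiableAt
  set D := deriv (fun x => aeval (γ x) p) x
  have hD : HasDerivAt (fun x => aeval (γ x) p) D x := hdiff.hasDerivAt
  have h0 : HasDerivAt (fun x => aeval (γ x) p * (γ x - algebraMap ℂ A μ))
      (D * (γ x - algebraMap ℂ A μ) + aeval (γ x) p * w) x := hD.mul (hγ.sub_const _)
  have hz : (fun x => aeval (γ x) p * (γ x - algebraMap ℂ A μ)) = fun _ => 0 := by
    ext1 y
    rw [← hp y]
    simp
  rw [hz] at h0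
  have h1 : D * (γ x - algebraMap ℂ A μ) + aeval (γ x) p * w = 0 :=
    h0.unique (hasDerivAt_const x 0)
  have h2 : (γ x - algebraMap ℂ A μ) * aeval (γ x) p = 0 := by
    rw [← hp x, mul_comm p, map_mul]
    simp
  -- Right multiplication of the differentiated identity by `p(γ)` removes the term containing the
  -- unknown derivative `D` of `p(γ)`.
  calc aeval (γ x) p * w * aeval (γ x) p
      = (D * (γ x - algebraMap ℂ A μ) + aeval (γ x) p * w) * aeval (γ x) p
        - D * ((γ x - algebraMap ℂ A μ) * aeval (γ x) p) := by noncomm_ring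
    _ = 0 := by rw [h1, h2]; simp

/-- For `y` diagonalizable with spectrum `s`, the map which vanishes on the centralizer of `y` and
is inverse to `v ↦ [v, y]` on the range of this map. -/
noncomputable def adInv (s : Finset ℂ) (y : A) : A →L[ℝ] A :=
  -- The Lagrange polynomials at `y` are the spectral projections. The terms with `ν = μ` drop out
  -- because `0⁻¹ = 0`. Being polynomial in `y`, the expression is smooth on the whole algebra, not
  -- only on an orbit.
  ∑ μ ∈ s, ∑ ν ∈ s, ContinuousLinearMap.mulLeftRight ℝ A
    (aeval y (C (ν - μ)⁻¹ * Lagrange.basis s id μ)) (aeval y (Lagrange.basis s id ν))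

theorem adInv_apply (s : Finset ℂ) (y w : A) : adInv s y w = ∑ μ ∈ s, ∑ ν ∈ s,
    aeval y (C (ν - μ)⁻¹ * Lagrange.basis s id μ) * w * aeval y (Lagrange.basis s id ν) := by
  simp [adInv]

theorem temperate_adInv (s : Finset ℂ) : (adInv s : A → A →L[ℝ] A).HasTemperateGrowth :=
  Function.HasTemperateGrowth.sum fun _ _ => Function.HasTemperateGrowth.sum fun _ _ =>
    (ContinuousLinearMap.mulLeftRight ℝ A).bilinear_hasTemperateGrowth
      (temperate_aeval _) (temperate_aeval _)

theorem adInv_conj (s : Finset ℂ) {g g' y w : A} (h₁ : g' * g = 1) (h₂ : g * g' = 1) :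
    adInv s (g * y * g') w = g * adInv s y (g' * w * g) * g' := by
  simp only [adInv_apply, Finset.mul_sum, Finset.sum_mul]
  refine Finset.sum_congr rfl fun μ _ => Finset.sum_congr rfl fun ν _ => ?_
  rw [aeval_conj h₁ h₂, aeval_conj h₁ h₂]
  noncomm_ring

end Algebra

/-! ### Matrices and the centralizer of a diagonal matrix -/

section Matrices

variable {n : ℕ}

/-- The entries of `y` which commute with the diagonal matrix `a` vanish. -/
def OffDiag (a y : Mat n) : Prop := ∀ i j, a i i = a j j → y i j = 0

theorem bracket_apply {a : Mat n} (ha : a.IsDiag) (y : Mat n) (i j : Fin n) :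
    ⁅y, a⁆ i j = (a j j - a i i) * y i j := by
  rw [← ha.diagonal_diag, Ring.lie_def, Matrix.sub_apply, Matrix.mul_diagonal,
    Matrix.diagonal_mul]
  simp only [Matrix.diag_apply, Matrix.diagonal_apply_eq]
  ring

theorem OffDiag.of_bracket {a : Mat n} (ha : a.IsDiag) (y : Mat n) : OffDiag a ⁅y, a⁆ :=
  fun i j h => by rw [bracket_apply ha, h, sub_self, zero_mul]

theorem apply_eq_zero_of_commute {a y : Mat n} (ha : a.IsDiag) (h : ⁅y, a⁆ = 0) {i j : Fin n}
    (hij : a i i ≠ a j j) : y i j = 0 := by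
  have := bracket_apply ha y i j
  rw [h, Matrix.zero_apply] at this
  exact (mul_eq_zero.1 this.symm).resolve_left (sub_ne_zero.2 hij.symm)

theorem OffDiag.eq_zero {a y : Mat n} (ha : a.IsDiag) (h : OffDiag a y) (hc : ⁅y, a⁆ = 0) :
    y = 0 := by
  ext i j
  by_cases hij : a i i = a j j
  · exact h i j hij
  · exact apply_eq_zero_of_commute ha hc hij

theorem OffDiag.trace_mul {a y z : Mat n} (ha : a.IsDiag) (h : OffDiag a y) (hz : ⁅z, a⁆ = 0) :
    Matrix.trace (z * y) = 0 := by
  simp only [Matrix.trace, Matrix.diag_apply, Matrix.mul_apply]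
  refine Finset.sum_eq_zero fun i _ => Finset.sum_eq_zero fun j _ => ?_
  by_cases hij : a i i = a j j
  · rw [h j i hij.symm, mul_zero]
  · rw [apply_eq_zero_of_commute ha hz hij, zero_mul]

theorem OffDiag.sub {a y z : Mat n} (h : OffDiag a y) (h' : OffDiag a z) : OffDiag a (y - z) :=
  fun i j hij => by rw [Matrix.sub_apply, h i j hij, h' i j hij, sub_zero]

theorem OffDiag.bracket {a u z : Mat n} (ha : a.IsDiag) (h : OffDiag a u) (hz : ⁅z, a⁆ = 0) :
    OffDiag a ⁅u, z⁆ := by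
  intro i j hij
  rw [Ring.lie_def, Matrix.sub_apply, Matrix.mul_apply, Matrix.mul_apply, sub_eq_zero]
  trans 0
  · refine Finset.sum_eq_zero fun l _ => ?_
    by_cases hl : a l l = a j j
    · rw [h i l (hij.trans hl.symm), zero_mul]
    · rw [apply_eq_zero_of_commute ha hz hl, mul_zero]
  · refine (Finset.sum_eq_zero fun l _ => ?_).symm
    by_cases hl : a i i = a l l
    · rw [h l j (hl.symm.trans hij), mul_zero]
    · rw [apply_eq_zero_of_commute ha hz hl, zero_mul]

theorem mem_uLie {y : Mat n} : y ∈ uLie n ↔ star y = -y := Iff.rfl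

theorem mem_centrPerp_iff {a : Mat n} (ha : a.IsDiag) {y : Mat n} :
    y ∈ centrPerp a ↔ y ∈ uLie n ∧ OffDiag a y := by
  refine and_congr_right fun hy => ⟨fun h => ?_, fun h z hz => ?_⟩
  -- The test element is the part of `y` that commutes with `a`: then `-tr (y z)` is the sum of `|y
  -- i j|²` over the entries with `a i i = a j j`.
  · let z : Mat n := fun i j => if a i i = a j j then y i j else 0
    have hent : ∀ i j, star (y j i) = -y i j := fun i j => congrFun (congrFun hy i) j
    have hz : z ∈ centr a := by
      constructor
      · ext i j
        change star (z j i) = -z i j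
        by_cases hij : a i i = a j j
        · simp only [z, if_pos hij, if_pos hij.symm, hent]
        · simp only [z, if_neg hij, if_neg (Ne.symm hij), star_zero, neg_zero]
      · ext i j
        rw [bracket_apply ha, Matrix.zero_apply]
        by_cases hij : a i i = a j j
        · rw [hij, sub_self, zero_mul]
        · simp only [z, if_neg hij, mul_zero]
    have h0 : ∑ i, ∑ j, (if a i i = a j j then ‖y i j‖ ^ 2 else 0) = (0 : ℝ) := by
      have h1 := h z hz
      simp only [Matrix.trace, Matrix.diag_apply, Matrix.mul_apply, ← Finset.sum_neg_distrib] at h1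
      have h2 : ∀ i j, -(y i j * z j i) =
          ((if a i i = a j j then ‖y i j‖ ^ 2 else 0 : ℝ) : ℂ) := by
        intro i j
        by_cases hij : a i i = a j j
        · simp only [z, if_pos hij, if_pos hij.symm]
          rw [← mul_neg, ← hent j i, Complex.ofReal_pow]
          exact Complex.mul_conj' _
        · simp only [z, if_neg hij, if_neg (Ne.symm hij), mul_zero, neg_zero, Complex.ofReal_zero]
      simp only [h2] at h1
      exact_mod_cast h1
    intro i j hij
    have h1 := (Finset.sum_eq_zero_iff_of_nonneg (fun i _ => Finset.sum_nonneg fun j _ => by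
      split_ifs <;> positivity)).1 h0 i (Finset.mem_univ _)
    have h2 := (Finset.sum_eq_zero_iff_of_nonneg (fun j _ => by
      split_ifs <;> positivity)).1 h1 j (Finset.mem_univ _)
    rw [if_pos hij] at h2
    exact norm_eq_zero.1 (pow_eq_zero_iff (two_ne_zero)|>.1 h2)
  · rw [Matrix.trace_mul_comm, h.trace_mul ha hz.2, neg_zero]

/-- The eigenvalues of a diagonal matrix. -/
noncomputable def eigs (a : Mat n) : Finset ℂ := Finset.univ.image a.diag

theorem diag_mem_eigs (a : Mat n) (i : Fin n) : a i i ∈ eigs a :=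
  Finset.mem_image_of_mem a.diag (Finset.mem_univ i)

theorem aeval_diag {a : Mat n} (ha : a.IsDiag) (p : Polynomial ℂ) :
    Polynomial.aeval a p = Matrix.diagonal fun i => p.eval (a i i) := by
  conv_lhs => rw [← ha.diagonal_diag]
  refine (Polynomial.aeval_algHom_apply (Matrix.diagonalAlgHom ℂ) a.diag p).trans ?_
  rw [Polynomial.aeval_pi_apply]
  rfl

theorem eval_basis_eigs {a : Mat n} {μ : ℂ} (hμ : μ ∈ eigs a) (i : Fin n) :
    (Lagrange.basis (eigs a) id μ).eval (a i i) = if a i i = μ then 1 else 0 := by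
  split_ifs with h
  · rw [h]
    exact Lagrange.eval_basis_self (v := id) Function.injective_id.injOn hμ
  · exact Lagrange.eval_basis_of_ne (v := id) (Ne.symm h) (diag_mem_eigs a i)

theorem adInv_self_apply {a : Mat n} (ha : a.IsDiag) (w : Mat n) (i j : Fin n) :
    (adInv (eigs a) a w : Mat n) i j = (a j j - a i i)⁻¹ * w i j := by
  rw [adInv_apply]
  simp only [Matrix.sum_apply, aeval_diag ha, Matrix.diagonal_mul, Matrix.mul_diagonal,
    Polynomial.eval_mul, Polynomial.eval_C]
  rw [Finset.sum_eq_single_of_mem (a i i) (diag_mem_eigs a i),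
    Finset.sum_eq_single_of_mem (a j j) (diag_mem_eigs a j)]
  · rw [eval_basis_eigs (diag_mem_eigs a i), eval_basis_eigs (diag_mem_eigs a j)]
    simp
  · intro ν hν hne
    rw [eval_basis_eigs hν, if_neg hne.symm, mul_zero]
  · intro μ hμ hne
    refine Finset.sum_eq_zero fun ν _ => ?_
    rw [eval_basis_eigs hμ, if_neg hne.symm]
    simp

theorem adInv_bracket {a u : Mat n} (ha : a.IsDiag) (hu : OffDiag a u) :
    adInv (eigs a) a ⁅u, a⁆ = u := by
  ext i j
  rw [adInv_self_apply ha, bracket_apply ha]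
  by_cases hij : a i i = a j j
  · rw [hu i j hij, mul_zero, mul_zero]
  · rw [inv_mul_cancel_left₀ (sub_ne_zero.2 (Ne.symm hij))]

theorem bracket_adInv {a w : Mat n} (ha : a.IsDiag) (hw : OffDiag a w) :
    ⁅(adInv (eigs a) a w : Mat n), a⁆ = w := by
  ext i j
  rw [bracket_apply ha, adInv_self_apply ha]
  by_cases hij : a i i = a j j
  · rw [hw i j hij, mul_zero, mul_zero]
  · rw [mul_inv_cancel_left₀ (sub_ne_zero.2 (Ne.symm hij))]

theorem adInv_mem_centrPerp {a w : Mat n} (hau : a ∈ uLie n) (ha : a.IsDiag) (hw : w ∈ uLie n) :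
    (adInv (eigs a) a w : Mat n) ∈ centrPerp a := by
  refine (mem_centrPerp_iff ha).2 ⟨?_, fun i j hij => ?_⟩
  · ext i j
    have h1 : ∀ i j, star (w j i) = -w i j := fun i j => congrFun (congrFun hw i) j
    have h2 : ∀ i, star (a i i) = -a i i := fun i => congrFun (congrFun hau i) i
    change star ((adInv (eigs a) a w : Mat n) j i) = -((adInv (eigs a) a w : Mat n) i j)
    rw [adInv_self_apply ha, adInv_self_apply ha, star_mul', star_inv₀, star_sub, h1, h2, h2]
    rw [show -a i i - -a j j = a j j - a i i by ring, mul_neg]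
  · rw [adInv_self_apply ha, hij, sub_self, inv_zero, zero_mul]

theorem star_conj_mem_uLie {g w : Mat n} (hw : w ∈ uLie n) : star g * w * g ∈ uLie n := by
  rw [mem_uLie] at hw ⊢
  simp only [star_mul, star_star, hw]
  noncomm_ring

theorem conj_mem_uLie {g w : Mat n} (hw : w ∈ uLie n) : g * w * star g ∈ uLie n := by
  simpa using star_conj_mem_uLie (g := star g) hw

theorem mem_adjOrbit_iff {a y : Mat n} : y ∈ adjOrbit a ↔
    ∃ g : Mat n, star g * g = 1 ∧ g * star g = 1 ∧ y = g * a * star g := by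
  constructor
  · rintro ⟨g, hg, rfl⟩
    have h := Matrix.mem_unitaryGroup_iff'.1 hg
    exact ⟨g, h, Matrix.mem_unitaryGroup_iff.1 hg, by rw [Matrix.inv_eq_left_inv h]⟩
  · rintro ⟨g, h, h', rfl⟩
    exact ⟨g, Matrix.mem_unitaryGroup_iff.2 h', by rw [Matrix.inv_eq_left_inv h]⟩

/-- A velocity at a point `g a g⁻¹` of a path in the orbit of `a` is tangent to the orbit. -/
theorem offDiag_of_hasDerivAt {a : Mat n} (ha : a.IsDiag) {γ : ℝ → Mat n}
    (hγ : ∀ x, γ x ∈ adjOrbit a) {x : ℝ} {w : Mat n} (hw : HasDerivAt γ w x) {g : Mat n}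
    (h₁ : star g * g = 1) (h₂ : g * star g = 1) (hg : γ x = g * a * star g) :
    OffDiag a (star g * w * g) := by
  intro i j hij
  -- Here `p(γ)` is a spectral projection, and its annihilating identity holds at each point
  -- separately, so no smooth lift of the path to the unitary group is needed.
  set p := Lagrange.basis (eigs a) id (a i i)
  have hp : ∀ y, Polynomial.aeval (γ y) (p * (Polynomial.X - Polynomial.C (a i i))) = 0 := by
    intro y
    obtain ⟨h, k₁, k₂, hy⟩ := mem_adjOrbit_iff.1 (hγ y)
    rw [hy, aeval_conj k₁ k₂, aeval_diag ha]
    have : (fun l => (p * (Polynomial.X - Polynomial.C (a i i))).eval (a l l)) = 0 := by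
      ext1 l
      rw [Polynomial.eval_mul, eval_basis_eigs (diag_mem_eigs a i)]
      split_ifs with hl
      · simp [hl]
      · simp
    rw [this]
    simp
  have h0 : Polynomial.aeval (γ x) p * w * Polynomial.aeval (γ x) p = 0 :=
    aeval_mul_deriv_mul_aeval hp hw
  rw [hg, aeval_conj h₁ h₂] at h0
  have h3 : Polynomial.aeval a p * (star g * w * g) * Polynomial.aeval a p = 0 := by
    calc Polynomial.aeval a p * (star g * w * g) * Polynomial.aeval a p
        = (star g * g) * Polynomial.aeval a p * (star g * w * g) * Polynomial.aeval a p *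
          (star g * g) := by rw [h₁]; simp
      _ = star g * (g * Polynomial.aeval a p * star g * w *
          (g * Polynomial.aeval a p * star g)) * g := by noncomm_ring
      _ = 0 := by rw [h0]; simp
  have h4 := congrFun (congrFun h3 i) j
  rw [aeval_diag ha, Matrix.mul_diagonal, Matrix.diagonal_mul, eval_basis_eigs (diag_mem_eigs a i),
    eval_basis_eigs (diag_mem_eigs a i), if_pos rfl, if_pos hij.symm] at h4
  simpa using h4

theorem bracket_conj {g y z : Mat n} (h₁ : star g * g = 1) :
    ⁅g * y * star g, g * z * star g⁆ = g * ⁅y, z⁆ * star g := by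
  have : ∀ y z : Mat n, g * y * star g * (g * z * star g) = g * (y * z) * star g := fun y z => by
    calc g * y * star g * (g * z * star g) = g * y * (star g * g) * z * star g := by noncomm_ring
      _ = g * (y * z) * star g := by rw [h₁]; noncomm_ring
  rw [Ring.lie_def, Ring.lie_def, this, this]
  noncomm_ring

theorem exists_unitary_bound (n : ℕ) : ∃ K : ℝ, ∀ g : Mat n, star g * g = 1 → ‖g‖ ≤ K := by
  refine ⟨(∑ _i : Fin n, ∑ _j : Fin n, (1 : ℝ)) ^ (1 / 2 : ℝ), fun g hg => ?_⟩
  rw [Matrix.frobenius_norm_def]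
  refine Real.rpow_le_rpow (by positivity) (Finset.sum_le_sum fun i _ =>
    Finset.sum_le_sum fun j _ => ?_) (by norm_num)
  have : ‖g i j‖ ≤ 1 := entry_norm_bound_of_unitary (Matrix.mem_unitaryGroup_iff'.2 hg) i j
  exact_mod_cast pow_le_one₀ (norm_nonneg _) this

end Matrices

/-! ### The development map -/

section DevelopmentMap

variable {n : ℕ} {a : Mat n}

theorem isRapid_iff {f : ℝ → Mat n} : IsRapid f ↔ IsSchwartz f := Iff.rfl

/-- The coefficient `v` of the linear equation `g_x = v g` of the frame along `γ`. -/
noncomputable def frameCoeff (a : Mat n) (γ : ℝ → Mat n) (x : ℝ) : Mat n :=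
  adInv (eigs a) (γ x) (deriv γ x)

theorem mem_uLie_of_mem_adjOrbit {y : Mat n} (hau : a ∈ uLie n) (hy : y ∈ adjOrbit a) :
    y ∈ uLie n := by
  obtain ⟨g, -, -, rfl⟩ := mem_adjOrbit_iff.1 hy
  exact conj_mem_uLie hau

theorem mem_uLie_of_hasDerivAt {f : ℝ → Mat n} {w : Mat n} {x : ℝ} (hf : ∀ x, f x ∈ uLie n)
    (h : HasDerivAt f w x) : w ∈ uLie n := by
  have h1 : HasDerivAt (fun x => star (f x)) (star w) x := HasDerivAt.star (F := Mat n) h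
  have h2 : (fun x => star (f x)) = fun x => -f x := funext fun x => hf x
  rw [h2] at h1
  exact h1.unique (HasDerivAt.neg (F := Mat n) h)

theorem exists_adjOrbit_bound (a : Mat n) : ∃ C : ℝ, ∀ y ∈ adjOrbit a, ‖y‖ ≤ C := by
  obtain ⟨K, hK⟩ := exists_unitary_bound n
  refine ⟨K * ‖a‖ * K, fun y hy => ?_⟩
  obtain ⟨g, h₁, -, rfl⟩ := mem_adjOrbit_iff.1 hy
  exact norm_mul_three_le (hK g h₁) le_rfl ((norm_star g).trans_le (hK g h₁))

section Path

variable {γ : ℝ → Mat n} (hau : a ∈ uLie n) (ha : a.IsDiag) (hγ : γ ∈ pathSpace a)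
include hγ

theorem path_hasDerivAt (x : ℝ) : HasDerivAt γ (deriv γ x) x :=
  (hγ.1.differentiable (by simp) x).hasDerivAt

theorem path_temperate : γ.HasTemperateGrowth := by
  obtain ⟨C, hC⟩ := exists_adjOrbit_bound a
  exact temperate_of_hasDerivAt (path_hasDerivAt hγ) (isRapid_iff.2 hγ.2.2.2).temperate
    fun x => hC _ (hγ.2.1 x)

theorem frameCoeff_rapid : IsRapid (frameCoeff a γ) :=
  IsRapid.clm_apply ((temperate_adInv (eigs a)).comp (path_temperate hγ))
    (isRapid_iff.2 hγ.2.2.2)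

include hau

theorem path_deriv_mem_uLie (x : ℝ) : deriv γ x ∈ uLie n :=
  mem_uLie_of_hasDerivAt (fun x => mem_uLie_of_mem_adjOrbit hau (hγ.2.1 x)) (path_hasDerivAt hγ x)

include ha

theorem frameCoeff_mem_uLie (x : ℝ) : frameCoeff a γ x ∈ uLie n := by
  obtain ⟨g, h₁, h₂, hg⟩ := mem_adjOrbit_iff.1 (hγ.2.1 x)
  rw [frameCoeff, hg, adInv_conj _ h₁ h₂]
  exact conj_mem_uLie
    (adInv_mem_centrPerp hau ha (star_conj_mem_uLie (path_deriv_mem_uLie hau hγ x))).1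

omit hau in
-- Since `γ_x` is tangent to the orbit, it lies in the range of `ad γ`, where `adInv` inverts the
-- bracket.
theorem bracket_frameCoeff (x : ℝ) : ⁅frameCoeff a γ x, γ x⁆ = deriv γ x := by
  obtain ⟨g, h₁, h₂, hg⟩ := mem_adjOrbit_iff.1 (hγ.2.1 x)
  have hoff := offDiag_of_hasDerivAt ha hγ.2.1 (path_hasDerivAt hγ x) h₁ h₂ hg
  rw [frameCoeff, hg, adInv_conj _ h₁ h₂, bracket_conj h₁, bracket_adInv ha hoff]
  calc g * (star g * deriv γ x * g) * star g
      = (g * star g) * deriv γ x * (g * star g) := by noncomm_ring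
    _ = deriv γ x := by rw [h₂]; simp

theorem exists_path_frame : ∃ g, IsUnitarySolution (frameCoeff a γ) g :=
  exists_unitarySolution (frameCoeff_rapid hγ) (frameCoeff_mem_uLie hau ha hγ)

variable {g : ℝ → Mat n} (hg : IsUnitarySolution (frameCoeff a γ) g)
include hg

/-- The derivative of `g* γ g` is `g* (γ_x - [v, γ]) g = 0`, and its limit at `-∞` is `a`. -/
theorem path_eq_conj (x : ℝ) : γ x = g x * a * star (g x) := by
  have h : star (g x) * γ x * g x = a := by
    refine eq_of_hasDerivAt_zero (f := fun x => star (g x) * γ x * g x) (l := atBot)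
      (fun x => ?_) ?_ x
    · refine (((hg.deriv x).star.mul (path_hasDerivAt hγ x)).mul (hg.deriv x)).congr_deriv ?_
      rw [star_mul, mem_uLie.1 (frameCoeff_mem_uLie hau ha hγ x), ← bracket_frameCoeff ha hγ x,
        Ring.lie_def, Pi.mul_apply]
      noncomm_ring
    · simpa using (hg.lim.star.mul hγ.2.2.1).mul hg.lim
  calc γ x = (g x * star (g x)) * γ x * (g x * star (g x)) := by
        rw [hg.mul_star_self]; simp
    _ = g x * (star (g x) * γ x * g x) * star (g x) := by noncomm_ring
    _ = _ := by rw [h]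

theorem conj_frameCoeff (x : ℝ) : star (g x) * frameCoeff a γ x * g x =
    adInv (eigs a) a (star (g x) * deriv γ x * g x) := by
  rw [frameCoeff]
  conv_lhs => rw [path_eq_conj hau ha hγ hg x]
  rw [adInv_conj _ (hg.star_mul_self x) (hg.mul_star_self x)]
  set z := (adInv (eigs a) a (star (g x) * deriv γ x * g x) : Mat n)
  calc star (g x) * (g x * z * star (g x)) * g x
      = (star (g x) * g x) * z * (star (g x) * g x) := by noncomm_ring
    _ = z := by rw [hg.star_mul_self]; simp

theorem conj_frameCoeff_mem_schwartzPerp :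
    (fun x => star (g x) * frameCoeff a γ x * g x) ∈ schwartzPerp a := by
  refine ⟨((frameCoeff_rapid hγ).temperate_mul (temperate_star hg.temperate)).mul_temperate
    hg.temperate, fun x => ?_⟩
  simp only [conj_frameCoeff hau ha hγ hg x]
  exact adInv_mem_centrPerp hau ha (star_conj_mem_uLie (path_deriv_mem_uLie hau hγ x))

end Path

/-- Uniqueness of frames makes the arbitrary choice in `Psi` harmless. -/
theorem Psi_eq {u g : ℝ → Mat n} (hu : ∀ x, u x ∈ uLie n) (hg : ∀ x, HasDerivAt g (g x * u x) x)
    (hlim : Tendsto g atBot (𝓝 1)) (hone : ∀ x, star (g x) * g x = 1) (x : ℝ) :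
    Psi a u x = g x * a * star (g x) := by
  have h : ∃ g, IsFrame u g := ⟨g, hg, hlim⟩
  have heq : ∀ x, h.choose x = g x :=
    frame_unique hu hg hlim hone h.choose_spec.1 h.choose_spec.2
  rw [Psi, dif_pos h, heq, Matrix.inv_eq_left_inv (hone x)]

section Path

variable {γ g : ℝ → Mat n} (hau : a ∈ uLie n) (ha : a.IsDiag) (hγ : γ ∈ pathSpace a)
  (hg : IsUnitarySolution (frameCoeff a γ) g)
include hg

theorem frame_hasDerivAt (x : ℝ) :
    HasDerivAt g (g x * (star (g x) * frameCoeff a γ x * g x)) x := by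
  refine (hg.deriv x).congr_deriv ?_
  rw [← mul_assoc, ← mul_assoc, hg.mul_star_self, one_mul]

include hau ha hγ

theorem Psi_conj_frameCoeff : Psi a (fun x => star (g x) * frameCoeff a γ x * g x) = γ := by
  ext1 x
  rw [path_eq_conj hau ha hγ hg x]
  exact Psi_eq (fun x => ((conj_frameCoeff_mem_schwartzPerp hau ha hγ hg).2 x).1)
    (frame_hasDerivAt hg) hg.lim hg.star_mul_self x

/-- This is the injectivity of `Ψ`. If `h` is the frame of `u`, then `γ_x = h [u, a] h*`, so the
coefficient recovered from `γ` is `h u h*`. Thus `h` solves the same linear equation as `g` and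
equals it. -/
theorem eq_of_Psi_eq {u : ℝ → Mat n} (hu : u ∈ schwartzPerp a) (hΨ : Psi a u = γ) (x : ℝ) :
    u x = star (g x) * frameCoeff a γ x * g x := by
  have huL : ∀ x, u x ∈ uLie n := fun x => (hu.2 x).1
  obtain ⟨h, hd, hlim, h₁, h₂⟩ := exists_unitary_frame (isRapid_iff.2 hu.1) huL
  have hγh : γ = fun x => h x * a * star (h x) := by
    rw [← hΨ]
    exact funext fun x => Psi_eq huL hd hlim h₁ x
  have hγ' : ∀ x, deriv γ x = h x * ⁅u x, a⁆ * star (h x) := by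
    intro x
    refine HasDerivAt.deriv ?_
    rw [hγh]
    refine (((hd x).mul_const a).mul (hd x).star).congr_deriv ?_
    rw [star_mul, mem_uLie.1 (huL x), Ring.lie_def]
    noncomm_ring
  have hcoeff : ∀ x, frameCoeff a γ x * h x = h x * u x := by
    intro x
    have hx : star (h x) * (h x * ⁅u x, a⁆ * star (h x)) * h x = ⁅u x, a⁆ := by
      calc star (h x) * (h x * ⁅u x, a⁆ * star (h x)) * h x
          = (star (h x) * h x) * ⁅u x, a⁆ * (star (h x) * h x) := by noncomm_ring
        _ = _ := by rw [h₁]; simp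
    rw [frameCoeff, hγ', hγh, adInv_conj _ (h₁ x) (h₂ x), hx,
      adInv_bracket ha ((mem_centrPerp_iff ha).1 (hu.2 x)).2, mul_assoc, h₁, mul_one]
  have heq : ∀ x, h x = g x := hg.unique (frameCoeff_mem_uLie hau ha hγ)
    (fun x => (hd x).congr_deriv (hcoeff x).symm) hlim
  rw [← heq, mul_assoc, hcoeff, ← mul_assoc, h₁, one_mul]

theorem Phi_eq (x : ℝ) : Phi a γ x = star (g x) * frameCoeff a γ x * g x := by
  have h : ∃ u ∈ schwartzPerp a, Psi a u = γ :=
    ⟨_, conj_frameCoeff_mem_schwartzPerp hau ha hγ hg, Psi_conj_frameCoeff hau ha hγ hg⟩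
  exact eq_of_Psi_eq hau ha hγ hg (Function.invFunOn_mem h) (Function.invFunOn_eq h) x

theorem Phi_mem : Phi a γ ∈ schwartzPerp a := by
  rw [funext (Phi_eq hau ha hγ hg)]
  exact conj_frameCoeff_mem_schwartzPerp hau ha hγ hg

end Path

end DevelopmentMap

/-! ### Curves of paths -/

section TwoVariables

variable {E F : Type*} [NormedAddCommGroup E] [NormedSpace ℝ E] [NormedAddCommGroup F]
  [NormedSpace ℝ F]

theorem temperate_fderiv {f : E → F} (hf : f.HasTemperateGrowth) :
    (fderiv ℝ f).HasTemperateGrowth := by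
  refine ⟨hf.1.fderiv_right (by simp), fun m => ?_⟩
  obtain ⟨k, C, h⟩ := hf.2 (m + 1)
  exact ⟨k, C, fun x => by rw [norm_iteratedFDeriv_fderiv]; exact h x⟩

theorem hasDerivAt_left {f : ℝ × ℝ → E} (hf : ContDiff ℝ ∞ f) (s x : ℝ) :
    HasDerivAt (fun s => f (s, x)) (fderiv ℝ f (s, x) (1, 0)) s := by
  have h := (hf.differentiable (by simp) (s, x)).hasFDerivAt
  exact h.comp_hasDerivAt s ((hasDerivAt_id s).prodMk (hasDerivAt_const s x))

theorem hasDerivAt_right {f : ℝ × ℝ → E} (hf : ContDiff ℝ ∞ f) (s x : ℝ) :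
    HasDerivAt (fun x => f (s, x)) (fderiv ℝ f (s, x) (0, 1)) x := by
  have h := (hf.differentiable (by simp) (s, x)).hasFDerivAt
  exact h.comp_hasDerivAt x ((hasDerivAt_const x s).prodMk (hasDerivAt_id x))

theorem fderiv_apply_contDiff {f : ℝ × ℝ → E} (hf : ContDiff ℝ ∞ f) (z : ℝ × ℝ) :
    ContDiff ℝ ∞ fun q => fderiv ℝ f q z :=
  (hf.fderiv_right (m := ∞) (by simp)).clm_apply contDiff_const

/-- Symmetry of the mixed second derivatives in `s` and `x`. -/
theorem hasDerivAt_fderiv_left {f : ℝ × ℝ → E} (hf : ContDiff ℝ ∞ f) (s x : ℝ) :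
    HasDerivAt (fun x => fderiv ℝ f (s, x) (1, 0))
      (fderiv ℝ (fun q => fderiv ℝ f q (0, 1)) (s, x) (1, 0)) x := by
  refine (hasDerivAt_right (fderiv_apply_contDiff hf (1, 0)) s x).congr_deriv ?_
  have hd : DifferentiableAt ℝ (fderiv ℝ f) (s, x) :=
    (hf.fderiv_right (m := ∞) (by simp)).differentiable (by simp) _
  have happ : ∀ z : ℝ × ℝ, fderiv ℝ (fun q => fderiv ℝ f q z) (s, x) =
      (fderiv ℝ (fderiv ℝ f) (s, x)).flip z := fun z => by
    rw [fderiv_clm_apply hd (differentiableAt_const z)]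
    simp
  rw [happ, happ]
  exact second_derivative_symmetric
    (fun y => (hf.differentiable (by simp) y).hasFDerivAt) hd.hasFDerivAt _ _

/-- Restriction to `s = 0` is composition with an inclusion of norm at most one, so joint
derivatives of order `m + 1` control the `m`-th `x`-derivative of `∂_s f`. -/
theorem isRapid_slice {f : ℝ × ℝ → E} (hf : ContDiff ℝ ∞ f)
    (hb : ∀ p m : ℕ, ∃ C : ℝ, ∀ x : ℝ, |x| ^ p * ‖iteratedFDeriv ℝ m f (0, x)‖ ≤ C) :
    IsRapid fun x => fderiv ℝ f (0, x) (1, 0) := by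
  have hD : ContDiff ℝ ∞ (fderiv ℝ f) := hf.fderiv_right (m := ∞) (by simp)
  have h1 : IsRapid fun x => fderiv ℝ f (0, x) := by
    refine IsRapid.of_bounds (hD.comp (contDiff_const.prodMk contDiff_id)) fun p m => ?_
    obtain ⟨C, hC⟩ := hb p (m + 1)
    refine ⟨C, fun x => le_trans ?_ (hC x)⟩
    have heq : (fun x => fderiv ℝ f (0, x)) = fderiv ℝ f ∘ ContinuousLinearMap.inr ℝ ℝ ℝ := by
      ext1 y
      simp
    rw [heq, ContinuousLinearMap.iteratedFDeriv_comp_right (ContinuousLinearMap.inr ℝ ℝ ℝ)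
      hD x (i := m) (mod_cast le_top), ← norm_iteratedFDeriv_fderiv]
    refine mul_le_mul_of_nonneg_left ?_ (by positivity)
    refine (ContinuousMultilinearMap.norm_compContinuousLinearMap_le _ _).trans ?_
    refine mul_le_of_le_one_right (norm_nonneg _) (Finset.prod_le_one (fun _ _ => norm_nonneg _)
      fun _ _ => ContinuousLinearMap.norm_inr_le_one ℝ ℝ ℝ)
  exact h1.clm (ContinuousLinearMap.apply ℝ E ((1, 0) : ℝ × ℝ))

theorem le_inv_one_add_sq {t C₀ C₂ x : ℝ} (h₀ : |x| ^ 0 * t ≤ C₀) (h₂ : |x| ^ 2 * t ≤ C₂) :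
    t ≤ (C₀ + C₂) * (1 + x ^ 2)⁻¹ := by
  rw [← div_eq_mul_inv, le_div_iff₀ (by positivity)]
  rw [sq_abs] at h₂
  linarith

theorem norm_fderiv_left_le (f : ℝ × ℝ → E) (q : ℝ × ℝ) :
    ‖fderiv ℝ f q (1, 0)‖ ≤ ‖iteratedFDeriv ℝ 1 f q‖ := by
  refine (ContinuousLinearMap.le_opNorm _ _).trans ?_
  rw [norm_iteratedFDeriv_one, Prod.norm_def]
  simp

end TwoVariables

/-! ### The differential of `adInv` -/

section AdInvVariation

variable {A : Type*} [NormedRing A] [NormedAlgebra ℝ A] [Algebra ℂ A]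

/-- The differential of `(y, w) ↦ adInv s y w`. -/
noncomputable def adInvVar (s : Finset ℂ) (y y' w w' : A) : A :=
  fderiv ℝ (adInv s) y y' w + adInv s y w'

theorem hasDerivAt_adInv (s : Finset ℂ) {y w : ℝ → A} {y' w' : A} {t : ℝ}
    (hy : HasDerivAt y y' t) (hw : HasDerivAt w w' t) :
    HasDerivAt (fun t => adInv s (y t) (w t)) (adInvVar s (y t) y' (w t) w') t := by
  have hd : HasFDerivAt (adInv s : A → _) (fderiv ℝ (adInv s) (y t)) (y t) :=
    ((temperate_adInv s).1.differentiable (by simp) _).hasFDerivAt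
  exact (hd.comp_hasDerivAt t hy).clm_apply hw

theorem rapid_adInvVar (s : Finset ℂ) {y y' w w' : ℝ → A} (hy : y.HasTemperateGrowth)
    (hy' : y'.HasTemperateGrowth) (hw : IsRapid w) (hw' : IsRapid w') :
    IsRapid fun x => adInvVar s (y x) (y' x) (w x) (w' x) := by
  have h1 := temperate_adInv (A := A) s
  have h2 : (fun x => fderiv ℝ (adInv s) (y x)).HasTemperateGrowth := (temperate_fderiv h1).comp hy
  have h3 : (fun x => fderiv ℝ (adInv s) (y x) (y' x)).HasTemperateGrowth :=
    ContinuousLinearMap.bilinear_hasTemperateGrowth (𝕜 := ℝ) (E := A →L[ℝ] A →L[ℝ] A) (F := A)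
      (G := A →L[ℝ] A) (ContinuousLinearMap.id ℝ _) h2 hy'
  exact (IsRapid.clm_apply h3 hw).add (IsRapid.clm_apply (h1.comp hy) hw')

end AdInvVariation

/-! ### Variation of the frame and of the development along a curve of paths -/

section Curve

variable {n : ℕ} {a : Mat n}

/-- The variation of `frameCoeff` along a variation `δ` of the path `γ`. -/
noncomputable def coeffVar (a : Mat n) (γ δ : ℝ → Mat n) (x : ℝ) : Mat n :=
  adInvVar (eigs a) (γ x) (δ x) (deriv γ x) (deriv δ x)

/-- The variation `g⁻¹ δg` of the frame `g` along a variation `δ` of the path `γ`. -/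
noncomputable def frameVar (a : Mat n) (γ δ g : ℝ → Mat n) (x : ℝ) : Mat n :=
  ∫ y in Iic x, star (g y) * coeffVar a γ δ y * g y

theorem curve_deriv_eq {c : ℝ → ℝ → Mat n} (hc : IsSmoothCurve a c) :
    (fun q : ℝ × ℝ => deriv (c q.1) q.2) =
      fun q => fderiv ℝ (fun q : ℝ × ℝ => c q.1 q.2) q (0, 1) :=
  funext fun q => (hasDerivAt_right hc.1 q.1 q.2).deriv

theorem curve_deriv_contDiff {c : ℝ → ℝ → Mat n} (hc : IsSmoothCurve a c) :
    ContDiff ℝ ∞ (fun q : ℝ × ℝ => deriv (c q.1) q.2) := by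
  rw [curve_deriv_eq hc]
  exact fderiv_apply_contDiff hc.1 (0, 1)

theorem velocity_eq {γ δ : ℝ → Mat n} {c : ℝ → ℝ → Mat n} (h : Represents a γ δ c) (x : ℝ) :
    δ x = fderiv ℝ (fun q : ℝ × ℝ => c q.1 q.2) (0, x) (1, 0) :=
  (h.2.2 x).unique (hasDerivAt_left h.1.1 0 x)

theorem velocity_hasDerivAt {γ δ : ℝ → Mat n} {c : ℝ → ℝ → Mat n} (h : Represents a γ δ c)
    (x : ℝ) : HasDerivAt δ
      (fderiv ℝ (fun q : ℝ × ℝ => deriv (c q.1) q.2) (0, x) (1, 0)) x := by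
  rw [funext (velocity_eq h), curve_deriv_eq h.1]
  exact hasDerivAt_fderiv_left h.1.1 0 x

theorem velocity_deriv_rapid {γ δ : ℝ → Mat n} {c : ℝ → ℝ → Mat n} (h : Represents a γ δ c) :
    IsRapid (deriv δ) := by
  rw [show deriv δ = _ from funext fun x => (velocity_hasDerivAt h x).deriv]
  refine isRapid_slice (curve_deriv_contDiff h.1) fun p m => ?_
  obtain ⟨C, hC⟩ := h.1.2.2 p m 1
  exact ⟨C, fun x => hC 0 (by simp) x⟩

theorem curve_hasDerivAt_deriv {γ δ : ℝ → Mat n} {c : ℝ → ℝ → Mat n} (h : Represents a γ δ c)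
    (x : ℝ) : HasDerivAt (fun s => deriv (c s) x) (deriv δ x) 0 :=
  (hasDerivAt_left (curve_deriv_contDiff h.1) 0 x).congr_deriv (velocity_hasDerivAt h x).deriv.symm

theorem curve_deriv_sub_le {c : ℝ → ℝ → Mat n} (hc : IsSmoothCurve a c) :
    ∃ C : ℝ, 0 ≤ C ∧ ∀ s ∈ Icc (-1 : ℝ) 1, ∀ x,
      ‖deriv (c s) x - deriv (c 0) x‖ ≤ C * (1 + x ^ 2)⁻¹ * |s| := by
  obtain ⟨C₀, h₀⟩ := hc.2.2 0 1 1
  obtain ⟨C₂, h₂⟩ := hc.2.2 2 1 1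
  have hb : ∀ s ∈ Icc (-1 : ℝ) 1, ∀ x,
      ‖fderiv ℝ (fun q : ℝ × ℝ => deriv (c q.1) q.2) (s, x) (1, 0)‖ ≤
        (C₀ + C₂) * (1 + x ^ 2)⁻¹ := by
    intro s hs x
    refine (norm_fderiv_left_le _ _).trans ?_
    exact le_inv_one_add_sq (h₀ s hs x) (h₂ s hs x)
  refine ⟨C₀ + C₂, ?_, fun s hs x => ?_⟩
  · simpa using (norm_nonneg _).trans (hb 0 (by simp) 0)
  · have := (convex_Icc (-1 : ℝ) 1).norm_image_sub_le_of_norm_hasDerivWithin_le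
      (f := fun s => deriv (c s) x)
      (fun t _ => (hasDerivAt_left (curve_deriv_contDiff hc) t x).hasDerivWithinAt)
      (fun t ht => hb t ht x) (show (0 : ℝ) ∈ Icc (-1 : ℝ) 1 by simp) hs
    simpa using this

theorem curve_deriv_le {c : ℝ → ℝ → Mat n} (hc : IsSmoothCurve a c) :
    ∃ C : ℝ, 0 ≤ C ∧ ∀ s ∈ Icc (-1 : ℝ) 1, ∀ x, ‖deriv (c s) x‖ ≤ C * (1 + x ^ 2)⁻¹ := by
  obtain ⟨C₀, h₀⟩ := hc.2.2 0 0 1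
  obtain ⟨C₂, h₂⟩ := hc.2.2 2 0 1
  have hb : ∀ s ∈ Icc (-1 : ℝ) 1, ∀ x, ‖deriv (c s) x‖ ≤ (C₀ + C₂) * (1 + x ^ 2)⁻¹ := by
    intro s hs x
    have h1 := h₀ s hs x
    have h2 := h₂ s hs x
    rw [norm_iteratedFDeriv_zero] at h1 h2
    exact le_inv_one_add_sq h1 h2
  exact ⟨C₀ + C₂, by simpa using (norm_nonneg _).trans (hb 0 (by simp) 0), hb⟩

/-- All paths start at `a`, so the difference is the integral from `-∞` of the difference of
derivatives. This makes the estimate uniform in `x`, although decay is assumed only for `∂ₓ c`. -/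
theorem curve_sub_le {c : ℝ → ℝ → Mat n} (hc : IsSmoothCurve a c) :
    ∃ C : ℝ, 0 ≤ C ∧ ∀ s ∈ Icc (-1 : ℝ) 1, ∀ x, ‖c s x - c 0 x‖ ≤ C * |s| := by
  obtain ⟨C, hC, hb⟩ := curve_deriv_sub_le hc
  refine ⟨C * Real.pi, by positivity, fun s hs x => ?_⟩
  have hs' := hc.2.1 s
  have h0' := hc.2.1 0
  have hint : ∫ y in Iic x, (deriv (c s) y - deriv (c 0) y) = c s x - c 0 x - (a - a) :=
    integral_Iic_eq_of_hasDerivAt (f := fun x => c s x - c 0 x)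
      (fun y => (path_hasDerivAt hs' y).sub (path_hasDerivAt h0' y))
      ((isRapid_iff.2 hs'.2.2.2).integrable.sub (isRapid_iff.2 h0'.2.2.2).integrable)
      (hs'.2.2.1.sub h0'.2.2.1) x
  rw [sub_self, sub_zero] at hint
  rw [← hint]
  have hi : Integrable fun y : ℝ => C * |s| * (1 + y ^ 2)⁻¹ := integrable_inv_one_add_sq.const_mul _
  refine (norm_integral_Iic_le hi (fun y => (hb s hs y).trans (le_of_eq (by ring))) x).trans
    ((integral_Iic_le hi (fun y => by positivity) x).trans (le_of_eq ?_))
  rw [integral_const_mul, integral_univ_inv_one_add_sq]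
  ring

theorem velocity_bounded {γ δ : ℝ → Mat n} {c : ℝ → ℝ → Mat n} (h : Represents a γ δ c) :
    ∃ C : ℝ, ∀ x, ‖δ x‖ ≤ C := by
  obtain ⟨C, hC, hb⟩ := curve_sub_le h.1
  refine ⟨C, fun x => HasDerivAt.le_of_lip' (h.2.2 x) hC ?_⟩
  filter_upwards [Icc_mem_nhds (show (-1 : ℝ) < 0 by norm_num) (show (0 : ℝ) < 1 by norm_num)]
    with s hs
  simpa using hb s hs x

theorem velocity_temperate {γ δ : ℝ → Mat n} {c : ℝ → ℝ → Mat n} (h : Represents a γ δ c) :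
    δ.HasTemperateGrowth := by
  obtain ⟨C, hC⟩ := velocity_bounded h
  exact temperate_of_hasDerivAt
    (fun x => (velocity_hasDerivAt h x).differentiableAt.hasDerivAt)
    (velocity_deriv_rapid h).temperate hC

/-- The orbit lies in a compact ball, on which `adInv` is bounded and Lipschitz; the integrable
weight comes from the `x`-derivatives. -/
theorem frameCoeff_sub_le {c : ℝ → ℝ → Mat n} (hc : IsSmoothCurve a c) :
    ∃ C : ℝ, ∀ s ∈ Icc (-1 : ℝ) 1, ∀ x,
      ‖frameCoeff a (c s) x - frameCoeff a (c 0) x‖ ≤ C * |s| * (1 + x ^ 2)⁻¹ := by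
  obtain ⟨C₁, hC₁, h₁⟩ := curve_deriv_sub_le hc
  obtain ⟨C₂, hC₂, h₂⟩ := curve_deriv_le hc
  obtain ⟨C₃, hC₃, h₃⟩ := curve_sub_le hc
  obtain ⟨R, hR⟩ := exists_adjOrbit_bound a
  have hmem : ∀ s x, c s x ∈ Metric.closedBall (0 : Mat n) R := fun s x =>
    mem_closedBall_zero_iff.2 (hR _ ((hc.2.1 s).2.1 x))
  have hcd : ContDiff ℝ ∞ (adInv (eigs a) : Mat n → _) := (temperate_adInv (eigs a)).1
  obtain ⟨L, hL⟩ := hcd.contDiffOn.exists_lipschitzOnWith (by simp)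
    (convex_closedBall (0 : Mat n) R) (isCompact_closedBall (0 : Mat n) R)
  obtain ⟨B, hB⟩ := (isCompact_closedBall (0 : Mat n) R).exists_bound_of_continuousOn
    hcd.continuous.continuousOn
  refine ⟨L * C₃ * C₂ + B * C₁, fun s hs x => ?_⟩
  have hsplit : frameCoeff a (c s) x - frameCoeff a (c 0) x =
      (adInv (eigs a) (c s x) - adInv (eigs a) (c 0 x)) (deriv (c s) x) +
        adInv (eigs a) (c 0 x) (deriv (c s) x - deriv (c 0) x) := by
    rw [map_sub, sub_apply, frameCoeff, frameCoeff]
    abel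
  have hd := hL.norm_sub_le (hmem s x) (hmem 0 x)
  have hB0 := (norm_nonneg _).trans (hB _ (hmem 0 x))
  rw [hsplit]
  refine (norm_add_le _ _).trans ?_
  calc _ ≤ (L * (C₃ * |s|)) * (C₂ * (1 + x ^ 2)⁻¹) + B * (C₁ * (1 + x ^ 2)⁻¹ * |s|) := by
        refine add_le_add ((ContinuousLinearMap.le_opNorm _ _).trans (mul_le_mul
          (hd.trans (mul_le_mul_of_nonneg_left (h₃ s hs x) L.2)) (h₂ s hs x) (norm_nonneg _)
            (by positivity)))
          ((ContinuousLinearMap.le_opNorm _ _).trans (mul_le_mul (hB _ (hmem 0 x)) (h₁ s hs x)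
            (norm_nonneg _) hB0))
    _ = _ := by ring

theorem frameCoeff_hasDerivAt {γ δ : ℝ → Mat n} {c : ℝ → ℝ → Mat n} (h : Represents a γ δ c)
    (x : ℝ) : HasDerivAt (fun s => frameCoeff a (c s) x) (coeffVar a γ δ x) 0 := by
  have := hasDerivAt_adInv (eigs a) (h.2.2 x) (curve_hasDerivAt_deriv h x)
  rw [h.2.1] at this
  exact this

theorem coeffVar_rapid {γ δ : ℝ → Mat n} {c : ℝ → ℝ → Mat n} (hγ : γ ∈ pathSpace a)
    (h : Represents a γ δ c) : IsRapid (coeffVar a γ δ) := by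
  exact rapid_adInvVar (eigs a) (path_temperate hγ) (velocity_temperate h)
    (isRapid_iff.2 hγ.2.2.2) (velocity_deriv_rapid h)

/-- Off-diagonal matrices are fixed by the continuous linear map `y ↦ adInv (eigs a) a ⁅y, a⁆`,
whose values are all off-diagonal; hence so is the derivative. -/
theorem OffDiag.of_hasDerivAt {f : ℝ → Mat n} {w : Mat n} {x : ℝ} (ha : a.IsDiag)
    (hf : ∀ x, OffDiag a (f x)) (h : HasDerivAt f w x) : OffDiag a w := by
  have h1 : HasDerivAt (fun x => adInv (eigs a) a ⁅f x, a⁆)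
      (adInv (eigs a) a ⁅w, a⁆) x := by
    refine (adInv (eigs a) a).hasFDerivAt.comp_hasDerivAt x ?_
    exact (HasDerivAt.mul_const (𝔸 := Mat n) h a).sub (HasDerivAt.const_mul (𝔸 := Mat n) a h)
  have h2 : (fun x => (adInv (eigs a) a ⁅f x, a⁆ : Mat n)) = f :=
    funext fun x => adInv_bracket ha (hf x)
  rw [h2] at h1
  rw [h.unique h1]
  intro i j hij
  rw [adInv_self_apply ha, hij, sub_self, inv_zero, zero_mul]

section Represents

variable {γ δ g : ℝ → Mat n} {c : ℝ → ℝ → Mat n} (hau : a ∈ uLie n) (ha : a.IsDiag)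
  (hγ : γ ∈ pathSpace a) (hg : IsUnitarySolution (frameCoeff a γ) g) (h : Represents a γ δ c)
include hau ha hγ hg h

theorem exists_curve_frame : ∃ G : ℝ → ℝ → Mat n,
    (∀ s, IsUnitarySolution (frameCoeff a (c s)) (G s)) ∧ (∀ x, G 0 x = g x) ∧
      ∀ x, HasDerivAt (fun s => G s x) (g x * frameVar a γ δ g x) 0 := by
  choose G hG using fun s => exists_path_frame hau ha (h.1.2.1 s)
  obtain ⟨K, hK⟩ := exists_unitary_bound n
  obtain ⟨C, hC⟩ := frameCoeff_sub_le h.1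
  have hskew : ∀ s x, star (frameCoeff a (c s) x) = -frameCoeff a (c s) x := fun s =>
    frameCoeff_mem_uLie hau ha (h.1.2.1 s)
  -- The frames `G s` were chosen independently for each `s`; uniqueness identifies the one at `s =
  -- 0`.
  have h0 : ∀ x, G 0 x = g x := by
    have hG0 := hG 0
    rw [h.2.1] at hG0
    exact hg.unique (frameCoeff_mem_uLie hau ha hγ) hG0.deriv hG0.lim
  refine ⟨G, hG, h0, fun x => ?_⟩
  refine (hasDerivAt_frame hskew (fun s => (frameCoeff_rapid (h.1.2.1 s)).continuous) hG
    (fun s x => hK _ ((hG s).star_mul_self x)) hC (frameCoeff_hasDerivAt h)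
    x).congr_deriv ?_
  simp only [h0, frameVar]

omit hγ hg in
theorem coeffVar_mem_uLie (x : ℝ) : coeffVar a γ δ x ∈ uLie n :=
  mem_uLie_of_hasDerivAt (fun s => frameCoeff_mem_uLie hau ha (h.1.2.1 s) x)
    (frameCoeff_hasDerivAt h x)

omit hau ha in
theorem conj_coeffVar_rapid : IsRapid fun x => star (g x) * coeffVar a γ δ x * g x :=
  ((coeffVar_rapid hγ h).temperate_mul (temperate_star hg.temperate)).mul_temperate hg.temperate

omit hau ha in
theorem frameVar_hasDerivAt (x : ℝ) :
    HasDerivAt (frameVar a γ δ g) (star (g x) * coeffVar a γ δ x * g x) x :=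
  hasDerivAt_integral_Iic (conj_coeffVar_rapid hγ hg h).continuous
    (conj_coeffVar_rapid hγ hg h).integrable x

omit hau ha hγ hg h in
theorem frameVar_tendsto : Tendsto (frameVar a γ δ g) atBot (𝓝 0) := tendsto_integral_Iic _

omit hau ha in
theorem frameVar_bounded : ∃ K : ℝ, ∀ x, ‖frameVar a γ δ g x‖ ≤ K :=
  ⟨_, fun x => (norm_integral_Iic_le (conj_coeffVar_rapid hγ hg h).integrable.norm
    (fun _ => le_rfl) x).trans
      (integral_Iic_le (conj_coeffVar_rapid hγ hg h).integrable.norm (fun _ => norm_nonneg _) x)⟩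

theorem frameVar_mem_uLie (x : ℝ) : frameVar a γ δ g x ∈ uLie n := by
  rw [mem_uLie, ← add_eq_zero_iff_eq_neg]
  refine eq_of_hasDerivAt_zero (f := fun x => star (frameVar a γ δ g x) + frameVar a γ δ g x)
    (l := atBot) (fun y => ?_) ?_ x
  · refine ((frameVar_hasDerivAt hγ hg h y).star.add
      (frameVar_hasDerivAt hγ hg h y)).congr_deriv ?_
    rw [mem_uLie.1 (star_conj_mem_uLie (coeffVar_mem_uLie hau ha h y)), neg_add_cancel]
  · have := (frameVar_tendsto (a := a) (γ := γ) (δ := δ) (g := g)).star.add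
      (frameVar_tendsto (a := a) (γ := γ) (δ := δ) (g := g))
    rw [star_zero, add_zero] at this
    exact this

/-- Differentiate `c s = G s a (G s)*` at `s = 0`, with `∂_s G = g η` and `η` skew. -/
theorem velocity_eq_conj (x : ℝ) : δ x = g x * ⁅frameVar a γ δ g x, a⁆ * star (g x) := by
  obtain ⟨G, hG, h0, hd⟩ := exists_curve_frame hau ha hγ hg h
  have h1 : HasDerivAt (fun s => G s x * a * star (G s x))
      (g x * frameVar a γ δ g x * a * star (G 0 x) + G 0 x * a * star (g x * frameVar a γ δ g x))
      0 := HasDerivAt.mul (𝔸 := Mat n) ((hd x).mul_const a) (hd x).star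
  have h2 : (fun s => c s x) = fun s => G s x * a * star (G s x) :=
    funext fun s => path_eq_conj hau ha (h.1.2.1 s) (hG s) x
  have h3 := h.2.2 x
  rw [h2] at h3
  rw [h3.unique h1, h0, star_mul, mem_uLie.1 (frameVar_mem_uLie hau ha hγ hg h x), Ring.lie_def]
  noncomm_ring

/-- The development map is differentiable along every curve. -/
theorem Phi_hasDerivAt (x : ℝ) : HasDerivAt (fun s => Phi a (c s) x)
    (star (g x) * coeffVar a γ δ x * g x + ⁅Phi a γ x, frameVar a γ δ g x⁆) 0 := by
  obtain ⟨G, hG, h0, hd⟩ := exists_curve_frame hau ha hγ hg h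
  have h2 : (fun s => Phi a (c s) x) = fun s => star (G s x) * frameCoeff a (c s) x * G s x :=
    funext fun s => Phi_eq hau ha (h.1.2.1 s) (hG s) x
  rw [h2]
  refine (HasDerivAt.mul (𝔸 := Mat n) (HasDerivAt.mul (𝔸 := Mat n) (hd x).star
    (frameCoeff_hasDerivAt h x)) (hd x)).congr_deriv ?_
  simp only [Pi.mul_apply]
  rw [h0, h.2.1, star_mul, mem_uLie.1 (frameVar_mem_uLie hau ha hγ hg h x),
    Phi_eq hau ha hγ hg, Ring.lie_def]
  noncomm_ring

end Represents

section Tangent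

variable {γ δ g : ℝ → Mat n} (hau : a ∈ uLie n) (ha : a.IsDiag)
  (hγ : γ ∈ pathSpace a) (hg : IsUnitarySolution (frameCoeff a γ) g) (hδ : δ ∈ tangentPath a γ)
include hau ha hγ hg hδ

/-- The right-hand side involves only `γ`, `g` and `δ`, so the curve chosen in `dPhi` does not
matter. -/
theorem dPhi_eq (x : ℝ) : dPhi a γ δ x =
    star (g x) * coeffVar a γ δ x * g x + ⁅Phi a γ x, frameVar a γ δ g x⁆ := by
  have h : ∃ c, Represents a γ δ c := hδ
  rw [dPhi, dif_pos h]
  exact (Phi_hasDerivAt hau ha hγ hg h.choose_spec x).deriv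

theorem dPhi_mem : dPhi a γ δ ∈ schwartzPerp a := by
  obtain ⟨c, h⟩ := hδ
  have hΦ : ∀ s, Phi a (c s) ∈ schwartzPerp a := fun s => by
    obtain ⟨g', hg'⟩ := exists_path_frame hau ha (h.1.2.1 s)
    exact Phi_mem hau ha (h.1.2.1 s) hg'
  have hder := Phi_hasDerivAt hau ha hγ hg h
  have heq := dPhi_eq hau ha hγ hg ⟨c, h⟩
  constructor
  · rw [← isRapid_iff, funext heq]
    have hu : IsRapid (Phi a γ) := isRapid_iff.2 (Phi_mem hau ha hγ hg).1
    obtain ⟨K, hK⟩ := frameVar_bounded hγ hg h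
    have hη : (frameVar a γ δ g).HasTemperateGrowth :=
      temperate_of_hasDerivAt (frameVar_hasDerivAt hγ hg h)
        (conj_coeffVar_rapid hγ hg h).temperate hK
    exact (conj_coeffVar_rapid hγ hg h).add ((hu.mul_temperate hη).sub (hu.temperate_mul hη))
  · intro x
    rw [heq]
    exact (mem_centrPerp_iff ha).2 ⟨mem_uLie_of_hasDerivAt (fun s => ((hΦ s).2 x).1) (hder x),
      OffDiag.of_hasDerivAt ha (fun s => ((mem_centrPerp_iff ha).1 ((hΦ s).2 x)).2) (hder x)⟩

end Tangent

end Curve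

/-! ### Laurent coefficients of the generating equations -/

section Bracket

variable {R : Type*} [Ring R]

theorem bracket_zero (x : R) : ⁅x, (0 : R)⁆ = 0 := by simp [Ring.lie_def]

theorem zero_bracket (x : R) : ⁅(0 : R), x⁆ = 0 := by simp [Ring.lie_def]

theorem neg_bracket_swap (x y : R) : -⁅y, x⁆ = ⁅x, y⁆ := by simp [Ring.lie_def]

end Bracket

section Coefficients

variable {n : ℕ}

theorem bracketConn_connU (ξ : ℝ → Loop n) (a : Mat n) (u : ℝ → Mat n) (x : ℝ) (j : ℤ) :
    bracketConn ξ (connU a u) x j =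
      ⁅ξ x (j - 1), a⁆ + ⁅ξ x j, u x⁆ - deriv (fun y => ξ y j) x := by
  rw [bracketConn, finsum_eq_sum_of_support_subset (s := {j - 1, j})]
  · rw [Finset.sum_pair (by omega)]
    simp [connU]
  · intro i hi
    by_contra hne
    simp only [Finset.coe_insert, Finset.coe_singleton, mem_insert_iff, mem_singleton_iff,
      not_or] at hne
    refine hi ?_
    simp only [connU]
    rw [if_neg (by omega), if_neg (by omega), bracket_zero]

theorem bracketConn_connPath (ξ : ℝ → Loop n) (γ : ℝ → Mat n) (x : ℝ) (j : ℤ) :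
    bracketConn ξ (connPath γ) x j = ⁅ξ x (j - 1), γ x⁆ - deriv (fun y => ξ y j) x := by
  rw [bracketConn, finsum_eq_single _ (j - 1)]
  · simp [connPath]
  · intro i hi
    rw [connPath, Pi.single_eq_of_ne (by omega), bracket_zero]

theorem loopForm_neg_one (k : ℤ) (A : Loop n) (y : Mat n) :
    loopForm (-1) (casimir k A) (Pi.single 0 y) = Matrix.trace (A (k - 1) * y) := by
  rw [loopForm, finsum_eq_single _ (-1)]
  · rw [casimir, sub_self, Pi.single_eq_same, neg_add_eq_sub]
  · intro i hi
    rw [Pi.single_eq_of_ne (by omega), mul_zero, Matrix.trace_zero]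

theorem loopForm_one (k : ℤ) (A : Loop n) (y : Mat n) :
    loopForm 1 (casimir k A) (Pi.single 1 y) = Matrix.trace (A k * y) := by
  rw [loopForm, finsum_eq_single _ 0]
  · rw [casimir, sub_zero, Pi.single_eq_same, zero_add]
  · intro i hi
    rw [Pi.single_eq_of_ne (by omega), mul_zero, Matrix.trace_zero]

theorem IsDecayingLoop.hasDerivAt {J : Set ℤ} {ξ : ℝ → Loop n} (h : IsDecayingLoop J ξ) (j : ℤ)
    (x : ℝ) : HasDerivAt (fun y => ξ y j) (deriv (fun y => ξ y j) x) x :=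
  ((h.2.2.2.1 j).differentiable (by simp) x).hasDerivAt

theorem IsDecayingLoop.deriv_eq_zero {J : Set ℤ} {ξ : ℝ → Loop n} (h : IsDecayingLoop J ξ) {j : ℤ}
    (hj : j ∉ J) (x : ℝ) : deriv (fun y => ξ y j) x = 0 := by
  rw [show (fun y => ξ y j) = fun _ => 0 from funext fun y => h.2.2.1 y j hj]
  exact deriv_const x _

theorem IsDecayingLoop.mono {J J' : Set ℤ} {ξ : ℝ → Loop n} (h : IsDecayingLoop J ξ)
    (hJ : J ⊆ J') : IsDecayingLoop J' ξ :=
  ⟨h.1, h.2.1, fun x j hj => h.2.2.1 x j fun hj' => hj (hJ hj'), h.2.2.2⟩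

/-- In power `0` only `[χ_{-1}, a]` survives, and positive powers vanish automatically. What remains
is the recursion `Dχ_j = [χ_{j-1}, a]`, with `D = d_x + ad u`, in finitely many powers. -/
theorem generatesU_iff_of_nonpos {a : Mat n} {k : ℤ} (hk : k ≤ 0) {u δ : ℝ → Mat n}
    {χ : ℝ → Loop n} : GeneratesU a k u δ χ ↔ IsDecayingLoop {j | j < 0} χ ∧
      (∀ x, δ x = ⁅χ x (-1), a⁆) ∧ ∀ j, k ≤ j → j < 0 → ∀ x,
        ⁅χ x (j - 1), a⁆ = deriv (fun y => χ y j) x + ⁅u x, χ x j⁆ := by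
  have h0 : GeneratesU a k u δ χ ↔ IsDecayingLoop {j | j < 0} χ ∧
      ∀ x, Pi.single 0 (δ x) = projGE k (bracketConn χ (connU a u) x) :=
    ⟨fun h => h.elim (fun h => h.2) fun h => absurd h.1 (by omega), fun h => Or.inl ⟨hk, h⟩⟩
  rw [h0]
  refine and_congr_right fun hχ => ⟨fun h => ⟨fun x => ?_, fun j hkj hj x => ?_⟩, fun h x => ?_⟩
  · have := congrFun (h x) 0
    rw [Pi.single_eq_same, projGE, if_pos hk, bracketConn_connU,
      hχ.2.2.1 x 0 (by simp), hχ.deriv_eq_zero (by simp)] at this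
    simpa [zero_bracket] using this
  · have := congrFun (h x) j
    rw [Pi.single_eq_of_ne (by omega), projGE, if_pos hkj, bracketConn_connU] at this
    rw [← neg_bracket_swap (χ x j) (u x)] at this
    rw [← sub_eq_zero.1 this.symm]
    abel
  · ext1 j
    rw [projGE]
    split_ifs with hkj
    · rw [bracketConn_connU]
      rcases lt_trichotomy j 0 with hj | rfl | hj
      · rw [Pi.single_eq_of_ne (by omega), h.2 j hkj hj x, ← neg_bracket_swap (χ x j) (u x)]
        abel
      · rw [Pi.single_eq_same, hχ.2.2.1 x 0 (by simp), hχ.deriv_eq_zero (by simp), h.1 x]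
        simp [zero_bracket]
      · rw [Pi.single_eq_of_ne (by omega), hχ.2.2.1 x j (by simp; omega),
          hχ.2.2.1 x (j - 1) (by simp; omega), hχ.deriv_eq_zero (by simp; omega)]
        simp [zero_bracket]
    · rw [Pi.single_eq_of_ne (by omega)]

/-- Now `χ_{-1} = 0`, so power `0` reads `δ = Dχ_0`; the recursion is the same, read upwards. -/
theorem generatesU_iff_of_pos {a : Mat n} {k : ℤ} (hk : 0 < k) {u δ : ℝ → Mat n}
    {χ : ℝ → Loop n} : GeneratesU a k u δ χ ↔ IsDecayingLoop {j | 0 ≤ j} χ ∧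
      (∀ x, δ x = deriv (fun y => χ y 0) x + ⁅u x, χ x 0⁆) ∧ ∀ j, 0 < j → j < k → ∀ x,
        ⁅χ x (j - 1), a⁆ = deriv (fun y => χ y j) x + ⁅u x, χ x j⁆ := by
  have h0 : GeneratesU a k u δ χ ↔ IsDecayingLoop {j | 0 ≤ j} χ ∧
      ∀ x, Pi.single 0 (δ x) = projLE (k - 1) (-bracketConn χ (connU a u) x) :=
    ⟨fun h => h.elim (fun h => absurd h.1 (by omega)) fun h => h.2, fun h => Or.inr ⟨hk, h⟩⟩
  rw [h0]
  refine and_congr_right fun hχ => ⟨fun h => ⟨fun x => ?_, fun j hj hkj x => ?_⟩, fun h x => ?_⟩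
  · have := congrFun (h x) 0
    rw [Pi.single_eq_same, projLE, if_pos (by omega), Pi.neg_apply, bracketConn_connU,
      hχ.2.2.1 x (0 - 1) (by simp), zero_bracket, ← neg_bracket_swap (χ x 0) (u x)] at this
    rw [this]
    abel
  · have := congrFun (h x) j
    rw [Pi.single_eq_of_ne (by omega), projLE, if_pos (by omega), Pi.neg_apply,
      bracketConn_connU, ← neg_bracket_swap (χ x j) (u x)] at this
    rw [← sub_eq_zero.1 (neg_eq_zero.1 this.symm)]
    abel
  · ext1 j
    rw [projLE]
    split_ifs with hkj
    · rw [Pi.neg_apply, bracketConn_connU, ← neg_bracket_swap (χ x j) (u x)]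
      rcases lt_trichotomy j 0 with hj | rfl | hj
      · rw [Pi.single_eq_of_ne (by omega), hχ.2.2.1 x j (by simp; omega),
          hχ.2.2.1 x (j - 1) (by simp; omega), hχ.deriv_eq_zero (by simp; omega)]
        simp [zero_bracket, bracket_zero]
      · rw [Pi.single_eq_same, hχ.2.2.1 x (0 - 1) (by simp), h.1 x, zero_bracket]
        abel
      · rw [Pi.single_eq_of_ne (by omega), h.2 j hj (by omega) x]
        abel
    · rw [Pi.single_eq_of_ne (by omega)]

/-- There is no constant term in `γ λ`, so the recursion has `d_x` in place of `D`, and the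
variation sits in power `1`, one higher than for `u`. -/
theorem generatesPath_iff_of_nonpos {k : ℤ} (hk : k ≤ 0) {γ δ : ℝ → Mat n}
    {ξ : ℝ → Loop n} : GeneratesPath k γ δ ξ ↔ IsDecayingLoop {j | j ≤ 0} ξ ∧
      (∀ x, δ x = ⁅ξ x 0, γ x⁆) ∧ ∀ j, k < j → j ≤ 0 → ∀ x,
        ⁅ξ x (j - 1), γ x⁆ = deriv (fun y => ξ y j) x := by
  have h0 : GeneratesPath k γ δ ξ ↔ IsDecayingLoop {j | j ≤ 0} ξ ∧
      ∀ x, Pi.single 1 (δ x) = projGE (k + 1) (bracketConn ξ (connPath γ) x) :=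
    ⟨fun h => h.elim (fun h => h.2) fun h => absurd h.1 (by omega), fun h => Or.inl ⟨hk, h⟩⟩
  rw [h0]
  refine and_congr_right fun hξ => ⟨fun h => ⟨fun x => ?_, fun j hkj hj x => ?_⟩, fun h x => ?_⟩
  · have := congrFun (h x) 1
    rw [Pi.single_eq_same, projGE, if_pos (by omega), bracketConn_connPath,
      hξ.deriv_eq_zero (by simp)] at this
    simpa [zero_bracket] using this
  · have := congrFun (h x) j
    rw [Pi.single_eq_of_ne (by omega), projGE, if_pos (by omega), bracketConn_connPath] at this
    exact sub_eq_zero.1 this.symm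
  · ext1 j
    rw [projGE]
    split_ifs with hkj
    · rw [bracketConn_connPath]
      rcases lt_trichotomy j 1 with hj | rfl | hj
      · rw [Pi.single_eq_of_ne (by omega), h.2 j (by omega) (by omega) x, sub_self]
      · rw [Pi.single_eq_same, hξ.deriv_eq_zero (by simp), h.1 x]
        simp
      · rw [Pi.single_eq_of_ne (by omega), hξ.2.2.1 x (j - 1) (by simp; omega),
          hξ.deriv_eq_zero (by simp; omega)]
        simp [zero_bracket]
    · rw [Pi.single_eq_of_ne (by omega)]

theorem generatesPath_iff_of_pos {k : ℤ} (hk : 0 < k) {γ δ : ℝ → Mat n}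
    {ξ : ℝ → Loop n} : GeneratesPath k γ δ ξ ↔ IsDecayingLoop {j | 0 < j} ξ ∧
      (∀ x, δ x = deriv (fun y => ξ y 1) x) ∧ ∀ j, 1 < j → j ≤ k → ∀ x,
        ⁅ξ x (j - 1), γ x⁆ = deriv (fun y => ξ y j) x := by
  have h0 : GeneratesPath k γ δ ξ ↔ IsDecayingLoop {j | 0 < j} ξ ∧
      ∀ x, Pi.single 1 (δ x) = projLE k (-bracketConn ξ (connPath γ) x) :=
    ⟨fun h => h.elim (fun h => absurd h.1 (by omega)) fun h => h.2, fun h => Or.inr ⟨hk, h⟩⟩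
  rw [h0]
  refine and_congr_right fun hξ => ⟨fun h => ⟨fun x => ?_, fun j hj hkj x => ?_⟩, fun h x => ?_⟩
  · have := congrFun (h x) 1
    rw [Pi.single_eq_same, projLE, if_pos (by omega), Pi.neg_apply, bracketConn_connPath,
      hξ.2.2.1 x (1 - 1) (by simp)] at this
    simpa [zero_bracket] using this
  · have := congrFun (h x) j
    rw [Pi.single_eq_of_ne (by omega), projLE, if_pos (by omega), Pi.neg_apply,
      bracketConn_connPath, neg_sub] at this
    exact (sub_eq_zero.1 this.symm).symm
  · ext1 j
    rw [projLE]
    split_ifs with hkj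
    · rw [Pi.neg_apply, bracketConn_connPath]
      rcases lt_trichotomy j 1 with hj | rfl | hj
      · rw [Pi.single_eq_of_ne (by omega), hξ.2.2.1 x (j - 1) (by simp; omega),
          hξ.deriv_eq_zero (by simp; omega)]
        simp [zero_bracket]
      · rw [Pi.single_eq_same, hξ.2.2.1 x (1 - 1) (by simp), h.1 x]
        simp [zero_bracket]
      · rw [Pi.single_eq_of_ne (by omega), h.2 j (by omega) (by omega) x, sub_self, neg_zero]
    · rw [Pi.single_eq_of_ne (by omega)]

theorem tendsto_conj_zero {h h' X : ℝ → Mat n} {K : ℝ} (hK : ∀ x, ‖h x‖ ≤ K)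
    (hK' : ∀ x, ‖h' x‖ ≤ K) {l : Filter ℝ} (hX : Tendsto X l (𝓝 0)) :
    Tendsto (fun x => h x * X x * h' x) l (𝓝 0) := by
  refine squeeze_zero_norm (a := fun x => K * ‖X x‖ * K)
    (fun x => norm_mul_three_le (hK x) le_rfl (hK' x)) ?_
  have := (tendsto_zero_iff_norm_tendsto_zero.1 hX).const_mul K
  simpa using this.mul_const K

/-- Conjugation with a smooth unitary gauge transformation, followed by a restriction of the powers
which occur, preserves the class of decaying loops. -/
theorem IsDecayingLoop.conj {J J' : Set ℤ} [DecidablePred (· ∈ J')] {ξ : ℝ → Loop n}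
    (hξ : IsDecayingLoop J ξ) {h h' : ℝ → Mat n} (hh : ContDiff ℝ ∞ h) (hh' : ContDiff ℝ ∞ h')
    (hu : ∀ x, star (h x) = h' x) (h₁ : ∀ x, h' x * h x = 1) :
    IsDecayingLoop J' fun x j => if j ∈ J' then h x * ξ x j * h' x else 0 := by
  obtain ⟨K, hK⟩ := exists_unitary_bound n
  have hb : ∀ x, ‖h x‖ ≤ K := fun x => hK _ ((hu x).symm ▸ h₁ x)
  have hb' : ∀ x, ‖h' x‖ ≤ K := fun x => by
    rw [← hu x, norm_star]
    exact hb x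
  obtain ⟨⟨ε, hε, hsum⟩, hskew, -, hsm, hlim⟩ := hξ
  refine ⟨⟨ε, hε, fun x r hr => ?_⟩, fun x j => ?_, fun x j hj => if_neg hj, fun j => ?_,
    fun j => ?_⟩
  · have hr0 : 0 < r := lt_trans (by positivity) hr
    refine Summable.of_nonneg_of_le (fun j => by positivity) (fun j => ?_)
      ((hsum x r hr).mul_left (K * K))
    dsimp only
    split_ifs
    · calc ‖h x * ξ x j * h' x‖ * r ^ j ≤ (K * ‖ξ x j‖ * K) * r ^ j :=
            mul_le_mul_of_nonneg_right (norm_mul_three_le (hb x) le_rfl (hb' x)) (by positivity)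
        _ = _ := by ring
    · rw [norm_zero, zero_mul]
      have := mul_self_nonneg K
      positivity
  · dsimp only
    split_ifs
    · rw [← hu x]
      exact conj_mem_uLie (hskew x j)
    · simp [mem_uLie]
  · dsimp only
    split_ifs
    · exact (hh.mul (hsm j)).mul hh'
    · exact contDiff_const
  · dsimp only
    split_ifs
    · exact ⟨tendsto_conj_zero hb hb' (hlim j).1, tendsto_conj_zero hb hb' (hlim j).2⟩
    · exact ⟨tendsto_const_nhds, tendsto_const_nhds⟩

end Coefficients

/-! ### Gauge transformation of the generating equations -/

section Gauge

variable {n : ℕ}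

/-- `g` is a smooth unitary gauge transformation from `d_x + a λ + u` to `d_x + γ λ`. -/
structure IsGauge (a : Mat n) (γ u g : ℝ → Mat n) : Prop where
  hasDerivAt : ∀ x, HasDerivAt g (g x * u x) x
  star_mul_self : ∀ x, star (g x) * g x = 1
  mul_star_self : ∀ x, g x * star (g x) = 1
  contDiff : ContDiff ℝ ∞ g
  skew : ∀ x, star (u x) = -u x
  offDiag : ∀ x, OffDiag a (u x)
  conj : ∀ x, γ x = g x * a * star (g x)

/-- The variations `δ` of `γ` and `δu` of `u` both come from the variation `g η` of the gauge
transformation `g`. -/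
structure IsVariation (a : Mat n) (u g δ δu η : ℝ → Mat n) : Prop where
  hasDerivAt : ∀ x, HasDerivAt η (δu x - ⁅u x, η x⁆) x
  tendsto : Tendsto η atBot (𝓝 0)
  bounded : ∃ K : ℝ, ∀ x, ‖η x‖ ≤ K
  conj : ∀ x, δ x = g x * ⁅η x, a⁆ * star (g x)
  offDiag : ∀ x, OffDiag a (δu x)

variable {a : Mat n} {γ u g : ℝ → Mat n}

theorem IsGauge.exists_bound (hg : IsGauge a γ u g) :
    ∃ K : ℝ, (∀ x, ‖g x‖ ≤ K) ∧ ∀ x, ‖star (g x)‖ ≤ K := by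
  obtain ⟨K, hK⟩ := exists_unitary_bound n
  exact ⟨K, fun x => hK _ (hg.star_mul_self x),
    fun x => (norm_star (g x)).trans_le (hK _ (hg.star_mul_self x))⟩

theorem IsGauge.pull_push (hg : IsGauge a γ u g) (x : ℝ) (y : Mat n) :
    star (g x) * (g x * y * star (g x)) * g x = y := by
  calc star (g x) * (g x * y * star (g x)) * g x
      = (star (g x) * g x) * y * (star (g x) * g x) := by noncomm_ring
    _ = y := by rw [hg.star_mul_self]; simp

theorem IsGauge.push_pull (hg : IsGauge a γ u g) (x : ℝ) (y : Mat n) :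
    g x * (star (g x) * y * g x) * star (g x) = y := by
  calc g x * (star (g x) * y * g x) * star (g x)
      = (g x * star (g x)) * y * (g x * star (g x)) := by noncomm_ring
    _ = y := by rw [hg.mul_star_self]; simp

theorem IsGauge.push_bracket (hg : IsGauge a γ u g) (x : ℝ) (y : Mat n) :
    g x * ⁅y, a⁆ * star (g x) = ⁅g x * y * star (g x), γ x⁆ := by
  rw [hg.conj, bracket_conj (hg.star_mul_self x)]

theorem IsGauge.pull_bracket (hg : IsGauge a γ u g) (x : ℝ) (y : Mat n) :
    star (g x) * ⁅y, γ x⁆ * g x = ⁅star (g x) * y * g x, a⁆ := by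
  rw [← hg.pull_push x ⁅star (g x) * y * g x, a⁆, hg.push_bracket, hg.push_pull]

/-- Conjugation by `g` turns `d_x + ad u` into `d_x`. -/
theorem IsGauge.push_hasDerivAt (hg : IsGauge a γ u g) {y : ℝ → Mat n} {y' : Mat n} {x : ℝ}
    (hy : HasDerivAt y y' x) : HasDerivAt (fun x => g x * y x * star (g x))
      (g x * (y' + ⁅u x, y x⁆) * star (g x)) x := by
  refine (HasDerivAt.mul (𝔸 := Mat n) (HasDerivAt.mul (𝔸 := Mat n) (hg.hasDerivAt x) hy)
    (hg.hasDerivAt x).star).congr_deriv ?_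
  rw [star_mul, hg.skew, Ring.lie_def]
  simp only [Pi.mul_apply]
  noncomm_ring

theorem IsGauge.pull_hasDerivAt (hg : IsGauge a γ u g) {y : ℝ → Mat n} {y' : Mat n} {x : ℝ}
    (hy : HasDerivAt y y' x) : HasDerivAt (fun x => star (g x) * y x * g x)
      (star (g x) * y' * g x - ⁅u x, star (g x) * y x * g x⁆) x := by
  refine (HasDerivAt.mul (𝔸 := Mat n) (HasDerivAt.mul (𝔸 := Mat n) (hg.hasDerivAt x).star hy)
    (hg.hasDerivAt x)).congr_deriv ?_
  rw [star_mul, hg.skew, Ring.lie_def]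
  simp only [Pi.mul_apply]
  noncomm_ring

/-- A parallel field which vanishes at `-∞` is zero. -/
theorem IsGauge.eq_zero_of_parallel (hg : IsGauge a γ u g) {κ : ℝ → Mat n}
    (hκ : ∀ x, HasDerivAt κ (-⁅u x, κ x⁆) x) (hlim : Tendsto κ atBot (𝓝 0)) (x : ℝ) :
    κ x = 0 := by
  obtain ⟨K, hK, hK'⟩ := hg.exists_bound
  have h : g x * κ x * star (g x) = 0 := by
    refine eq_of_hasDerivAt_zero (f := fun x => g x * κ x * star (g x)) (l := atBot)
      (fun y => ?_) (tendsto_conj_zero hK hK' hlim) x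
    refine (hg.push_hasDerivAt (hκ y)).congr_deriv ?_
    rw [neg_add_cancel, mul_zero, zero_mul]
  rw [← hg.pull_push x (κ x), h, mul_zero, zero_mul]

theorem bracket_sub_left (x y z : Mat n) : ⁅x - y, z⁆ = ⁅x, z⁆ - ⁅y, z⁆ := by
  simp only [Ring.lie_def]
  noncomm_ring

theorem bracket_sub_right (x y z : Mat n) : ⁅x, y - z⁆ = ⁅x, y⁆ - ⁅x, z⁆ := by
  simp only [Ring.lie_def]
  noncomm_ring

theorem IsGauge.eq_of_parallel (hg : IsGauge a γ u g) {y z w : ℝ → Mat n}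
    (hy : ∀ x, HasDerivAt y (w x - ⁅u x, y x⁆) x) (hz : ∀ x, HasDerivAt z (w x - ⁅u x, z x⁆) x)
    (hylim : Tendsto y atBot (𝓝 0)) (hzlim : Tendsto z atBot (𝓝 0)) (x : ℝ) : y x = z x := by
  refine sub_eq_zero.1 (hg.eq_zero_of_parallel (κ := fun x => y x - z x) (fun x => ?_) ?_ x)
  · refine (HasDerivAt.sub (F := Mat n) (hy x) (hz x)).congr_deriv ?_
    rw [bracket_sub_right]
    abel
  · simpa using hylim.sub hzlim

/-- A field `κ` in the centralizer of `a` which vanishes at `-∞` and for which `κ_x + [u, κ]` is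
off-diagonal is zero. -/
theorem IsGauge.eq_zero_of_commute (ha : a.IsDiag) (hg : IsGauge a γ u g) {κ w : ℝ → Mat n}
    (hκ : ∀ x, HasDerivAt κ (w x - ⁅u x, κ x⁆) x) (hw : ∀ x, OffDiag a (w x))
    (hc : ∀ x, ⁅κ x, a⁆ = 0) (hlim : Tendsto κ atBot (𝓝 0)) (x : ℝ) : κ x = 0 := by
  refine eq_of_hasDerivAt_zero (f := κ) (l := atBot) (fun y => (hκ y).congr_deriv ?_) hlim x
  -- The derivative of `κ` is off-diagonal, as both `w` and `[u, κ]` are, and it commutes with `a`,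
  -- as `κ` does. So it is zero.
  refine ((hw y).sub ((hg.offDiag y).bracket ha (hc y))).eq_zero ha ?_
  have h1 : HasDerivAt (fun y => ⁅κ y, a⁆) ⁅w y - ⁅u y, κ y⁆, a⁆ y :=
    (HasDerivAt.mul_const (𝔸 := Mat n) (hκ y) a).sub (HasDerivAt.const_mul (𝔸 := Mat n) a (hκ y))
  rw [funext hc] at h1
  exact h1.unique (hasDerivAt_const y _)

theorem IsGauge.eq_of_commute (ha : a.IsDiag) (hg : IsGauge a γ u g) {y z w w' : ℝ → Mat n}
    (hy : ∀ x, HasDerivAt y (w x - ⁅u x, y x⁆) x) (hz : ∀ x, HasDerivAt z (w' x - ⁅u x, z x⁆) x)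
    (hw : ∀ x, OffDiag a (w x)) (hw' : ∀ x, OffDiag a (w' x)) (hc : ∀ x, ⁅y x, a⁆ = ⁅z x, a⁆)
    (hylim : Tendsto y atBot (𝓝 0)) (hzlim : Tendsto z atBot (𝓝 0)) (x : ℝ) : y x = z x := by
  refine sub_eq_zero.1 (hg.eq_zero_of_commute ha (κ := fun x => y x - z x)
    (w := fun x => w x - w' x) (fun x => ?_) (fun x => (hw x).sub (hw' x)) (fun x => ?_) ?_ x)
  · refine (HasDerivAt.sub (F := Mat n) (hy x) (hz x)).congr_deriv ?_
    rw [bracket_sub_right]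
    abel
  · rw [bracket_sub_left, hc, sub_self]
  · simpa using hylim.sub hzlim

theorem hasDerivAt_of_eq {y z w w' : ℝ → Mat n} (h : ∀ x, y x = z x)
    (hy : ∀ x, HasDerivAt y (w x - ⁅u x, y x⁆) x)
    (hz : ∀ x, HasDerivAt z (w' x - ⁅u x, z x⁆) x) (x : ℝ) : w x = w' x := by
  have h1 := hy x
  rw [funext h] at h1
  exact sub_left_injective (h1.unique (hz x))

/-- The coefficient `ξ_j` of a loop in the gauge of `u`. -/
def pull (g : ℝ → Mat n) (ξ : ℝ → Loop n) (j : ℤ) (x : ℝ) : Mat n := star (g x) * ξ x j * g x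

theorem IsGauge.pull_tendsto (hg : IsGauge a γ u g) {J : Set ℤ} {ξ : ℝ → Loop n}
    (hξ : IsDecayingLoop J ξ) (j : ℤ) :
    Tendsto (pull g ξ j) atTop (𝓝 0) ∧ Tendsto (pull g ξ j) atBot (𝓝 0) := by
  obtain ⟨K, hK, hK'⟩ := hg.exists_bound
  exact ⟨tendsto_conj_zero hK' hK (hξ.2.2.2.2 j).1, tendsto_conj_zero hK' hK (hξ.2.2.2.2 j).2⟩

theorem IsGauge.pull_step (hg : IsGauge a γ u g) {J : Set ℤ} {ξ : ℝ → Loop n}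
    (hξ : IsDecayingLoop J ξ) {j : ℤ}
    (h : ∀ x, ⁅ξ x (j - 1), γ x⁆ = deriv (fun y => ξ y j) x) (x : ℝ) :
    HasDerivAt (pull g ξ j) (⁅pull g ξ (j - 1) x, a⁆ - ⁅u x, pull g ξ j x⁆) x := by
  refine (hg.pull_hasDerivAt (hξ.hasDerivAt j x)).congr_deriv ?_
  rw [← h, hg.pull_bracket]
  rfl

theorem IsDecayingLoop.step {J : Set ℤ} {χ : ℝ → Loop n} (hχ : IsDecayingLoop J χ) {j : ℤ} {x : ℝ}
    {w : Mat n} (h : w = deriv (fun y => χ y j) x + ⁅u x, χ x j⁆) :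
    HasDerivAt (fun y => χ y j) (w - ⁅u x, χ x j⁆) x := by
  rw [h, add_sub_cancel_right]
  exact hχ.hasDerivAt j x

variable {δ δu η : ℝ → Mat n} {J : Set ℤ} {ξ χ : ℝ → Loop n}

theorem IsVariation.pull_eq (hg : IsGauge a γ u g) (hη : IsVariation a u g δ δu η) (x : ℝ) :
    star (g x) * δ x * g x = ⁅η x, a⁆ := by
  rw [hη.conj, hg.pull_push]

theorem IsVariation.pull_zero_bracket (hg : IsGauge a γ u g) (hη : IsVariation a u g δ δu η)
    (h : ∀ x, δ x = ⁅ξ x 0, γ x⁆) (x : ℝ) : ⁅pull g ξ 0 x, a⁆ = ⁅η x, a⁆ := by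
  rw [← hη.pull_eq hg x, h, hg.pull_bracket]
  rfl

/-- The equation for `δ` fixes `ζ_0 = g⁻¹ ξ_0 g` only modulo the centralizer of `a`. One further
step of the recursion makes `Dζ_0` off-diagonal, like `Dη = δu`, and removes the ambiguity. -/
theorem IsVariation.pull_zero (ha : a.IsDiag) (hg : IsGauge a γ u g)
    (hη : IsVariation a u g δ δu η) (hξ : IsDecayingLoop J ξ) (h : ∀ x, δ x = ⁅ξ x 0, γ x⁆)
    (h0 : ∀ x, ⁅ξ x (0 - 1), γ x⁆ = deriv (fun y => ξ y 0) x) (x : ℝ) :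
    pull g ξ 0 x = η x :=
  hg.eq_of_commute ha (hg.pull_step hξ h0) hη.hasDerivAt (fun _ => OffDiag.of_bracket ha _)
    hη.offDiag (hη.pull_zero_bracket hg h) (hg.pull_tendsto hξ 0).2 hη.tendsto x

theorem IsVariation.eq_bracket (ha : a.IsDiag) (hg : IsGauge a γ u g)
    (hη : IsVariation a u g δ δu η) (hξ : IsDecayingLoop J ξ) (h : ∀ x, δ x = ⁅ξ x 0, γ x⁆)
    (h0 : ∀ x, ⁅ξ x (0 - 1), γ x⁆ = deriv (fun y => ξ y 0) x) (x : ℝ) :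
    δu x = ⁅pull g ξ (-1) x, a⁆ :=
  (hasDerivAt_of_eq (hη.pull_zero ha hg hξ h h0) (hg.pull_step hξ h0) hη.hasDerivAt x).symm

/-- Both fields satisfy `Dy = δu` and vanish at `-∞`. -/
theorem IsVariation.eq_zeroth (hg : IsGauge a γ u g) (hη : IsVariation a u g δ δu η)
    (hχ : IsDecayingLoop J χ) (h : ∀ x, δu x = deriv (fun y => χ y 0) x + ⁅u x, χ x 0⁆) (x : ℝ) :
    χ x 0 = η x :=
  hg.eq_of_parallel (fun x => hχ.step (h x)) hη.hasDerivAt (hχ.2.2.2.2 0).2 hη.tendsto x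

theorem IsGauge.contDiff_star (hg : IsGauge a γ u g) : ContDiff ℝ ∞ fun x => star (g x) :=
  ((starL' ℝ : Mat n ≃L[ℝ] Mat n) : Mat n →L[ℝ] Mat n).contDiff.comp hg.contDiff

open Classical in
/-- The loop `ξ` in the gauge of `u`, restricted to the powers in `J`. -/
noncomputable def pullLoop (g : ℝ → Mat n) (J : Set ℤ) (ξ : ℝ → Loop n) : ℝ → Loop n :=
  fun x j => if j ∈ J then star (g x) * ξ x j * g x else 0

open Classical in
/-- The loop `χ` in the gauge of `γ`, restricted to the powers in `J`. -/
noncomputable def pushLoop (g : ℝ → Mat n) (J : Set ℤ) (χ : ℝ → Loop n) : ℝ → Loop n :=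
  fun x j => if j ∈ J then g x * χ x j * star (g x) else 0

open Classical in
theorem IsGauge.pullLoop_decaying (hg : IsGauge a γ u g) (hξ : IsDecayingLoop J ξ) (J' : Set ℤ) :
    IsDecayingLoop J' (pullLoop g J' ξ) :=
  hξ.conj hg.contDiff_star hg.contDiff (fun _ => star_star _) hg.mul_star_self

open Classical in
theorem IsGauge.pushLoop_decaying (hg : IsGauge a γ u g) (hχ : IsDecayingLoop J χ) (J' : Set ℤ) :
    IsDecayingLoop J' (pushLoop g J' χ) :=
  hχ.conj hg.contDiff hg.contDiff_star (fun _ => rfl) hg.star_mul_self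

theorem pullLoop_apply {J : Set ℤ} {j : ℤ} (hj : j ∈ J) (x : ℝ) :
    pullLoop g J ξ x j = pull g ξ j x := if_pos hj

theorem pushLoop_apply {J : Set ℤ} {j : ℤ} (hj : j ∈ J) (x : ℝ) :
    pushLoop g J χ x j = g x * χ x j * star (g x) := if_pos hj

theorem IsGauge.deriv_pullLoop (hg : IsGauge a γ u g) (hξ : IsDecayingLoop J ξ) {J' : Set ℤ}
    {j : ℤ} (hj : j ∈ J') (h : ∀ x, ⁅ξ x (j - 1), γ x⁆ = deriv (fun y => ξ y j) x) (x : ℝ) :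
    deriv (fun y => pullLoop g J' ξ y j) x + ⁅u x, pullLoop g J' ξ x j⁆ =
      ⁅pull g ξ (j - 1) x, a⁆ := by
  rw [show (fun y => pullLoop g J' ξ y j) = pull g ξ j from funext fun y => pullLoop_apply hj y,
    pullLoop_apply hj, ← eq_sub_iff_add_eq]
  exact (hg.pull_step hξ h x).deriv

theorem IsGauge.deriv_pushLoop (hg : IsGauge a γ u g) (hχ : IsDecayingLoop J χ) {J' : Set ℤ}
    {j : ℤ} (hj : j ∈ J') {x : ℝ} {w : Mat n} (h : w = deriv (fun y => χ y j) x + ⁅u x, χ x j⁆) :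
    deriv (fun y => pushLoop g J' χ y j) x = g x * w * star (g x) := by
  rw [show (fun y => pushLoop g J' χ y j) = fun x => g x * χ x j * star (g x) from
    funext fun y => pushLoop_apply hj y, h]
  exact (hg.push_hasDerivAt (hχ.hasDerivAt j x)).deriv

/-- Transport of generating loops from `γ` to `u`. -/
theorem IsVariation.generatesU (ha : a.IsDiag) (hg : IsGauge a γ u g)
    (hη : IsVariation a u g δ δu η) {k l : ℤ} (hk : k ≤ 1) (hl : l ≤ 1) (hlk : k ≤ l ∨ l = 0)
    (hξ : GeneratesPath (k - 2) γ δ ξ) : ∃ χ, GeneratesU a l u δu χ := by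
  rw [generatesPath_iff_of_nonpos (by omega)] at hξ
  obtain ⟨hdec, h, hstep⟩ := hξ
  have h0 := hstep 0 (by omega) le_rfl
  rcases le_or_gt l 0 with hl0 | hl0
  · refine ⟨pullLoop g {j | j < 0} ξ, (generatesU_iff_of_nonpos hl0).2
      ⟨hg.pullLoop_decaying hdec _, fun x => ?_, fun j hj hj0 x => ?_⟩⟩
    · rw [pullLoop_apply (by simp)]
      exact hη.eq_bracket ha hg hdec h h0 x
    · rw [pullLoop_apply (show j - 1 ∈ {j : ℤ | j < 0} by simp; omega),
        hg.deriv_pullLoop hdec (show j ∈ {j : ℤ | j < 0} from hj0) (hstep j (by omega) (by omega))]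
  -- Order `1` requires nonnegative powers and imposes only `δu = Dχ_0`, so the constant loop `ζ_0 =
  -- η` suffices.
  · obtain rfl : l = 1 := by omega
    refine ⟨pullLoop g {0} ξ, (generatesU_iff_of_pos one_pos).2
      ⟨(hg.pullLoop_decaying hdec _).mono (by simp), fun x => ?_, fun j hj hj1 x => by omega⟩⟩
    rw [hg.deriv_pullLoop hdec (mem_singleton 0) h0]
    exact hη.eq_bracket ha hg hdec h h0 x

/-- Transport of generating loops from `u` to `γ`. -/
theorem IsVariation.generatesPath (hg : IsGauge a γ u g)
    (hη : IsVariation a u g δ δu η) {k l : ℤ} (hk : 0 < k) (hl : 0 ≤ l) (hlk : l + 2 ≤ k ∨ l = 0)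
    (hχ : GeneratesU a k u δu χ) : ∃ ξ, GeneratesPath l γ δ ξ := by
  rw [generatesU_iff_of_pos hk] at hχ
  obtain ⟨hdec, h, hstep⟩ := hχ
  have hχ0 := hη.eq_zeroth hg hdec h
  rcases hl.eq_or_lt with rfl | hl0
  -- For order `0` the constant loop `g η g⁻¹` suffices; it decays at `+∞` too because `η = χ_0`.
  · refine ⟨pushLoop g {0} χ, (generatesPath_iff_of_nonpos le_rfl).2
      ⟨(hg.pushLoop_decaying hdec _).mono (by simp), fun x => ?_, fun j hj hj1 x => by omega⟩⟩
    rw [pushLoop_apply (mem_singleton 0), ← hg.push_bracket, hχ0, hη.conj]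
  · refine ⟨pushLoop g {j | 0 < j} χ, (generatesPath_iff_of_pos hl0).2
      ⟨hg.pushLoop_decaying hdec _, fun x => ?_, fun j hj hjl x => ?_⟩⟩
    · rw [hg.deriv_pushLoop hdec (by simp) (hstep 1 one_pos (by omega) x), sub_self, hχ0, hη.conj]
    · rw [hg.deriv_pushLoop hdec (show j ∈ {j : ℤ | 0 < j} by simp; omega)
        (hstep j (by omega) (by omega) x), pushLoop_apply (show j - 1 ∈ {j : ℤ | 0 < j} by simp; omega),
        hg.push_bracket]

end Gauge

/-! ### The symplectic forms -/

section Pairing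

/-- Integrability over the line, with respect to the topology of the norm. -/
def IsIntegrable {E : Type*} [NormedAddCommGroup E] (f : ℝ → E) : Prop := Integrable f

theorem exists_bound_of_tendsto {E : Type*} [NormedAddCommGroup E] {f : ℝ → E} (hf : Continuous f)
    (htop : Tendsto f atTop (𝓝 0)) (hbot : Tendsto f atBot (𝓝 0)) : ∃ C : ℝ, ∀ x, ‖f x‖ ≤ C := by
  have hlim : Tendsto f (cocompact ℝ) (𝓝 0) := by
    rw [cocompact_eq_atBot_atTop]
    exact hbot.sup htop
  let φ : ZeroAtInftyContinuousMap ℝ E := ⟨⟨f, hf⟩, hlim⟩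
  obtain ⟨C, hC⟩ := (isBounded_iff_forall_norm_le).1 φ.isBounded_range
  exact ⟨C, fun x => hC _ ⟨x, rfl⟩⟩

variable {A : Type*} [NormedRing A] [NormedAlgebra ℝ A]

theorem integrable_pairing (T : A →L[ℝ] ℂ) {f y : ℝ → A} (hf : Continuous f)
    (htop : Tendsto f atTop (𝓝 0)) (hbot : Tendsto f atBot (𝓝 0)) (hy : IsIntegrable y) :
    Integrable fun x => T (f x * y x) := by
  obtain ⟨C, hC⟩ := exists_bound_of_tendsto hf htop hbot
  have hy' : Integrable y volume := hy
  exact T.integrable_comp (hy'.bdd_mul hf.aestronglyMeasurable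
    (Eventually.of_forall hC))

theorem hasDerivAt_pairing (T : A →L[ℝ] ℂ) {f y : ℝ → A} {f' y' : A} {x : ℝ}
    (hf : HasDerivAt f f' x) (hy : HasDerivAt y y' x) :
    HasDerivAt (fun x => T (f x * y x)) (T (f' * y x + f x * y')) x :=
  T.hasFDerivAt.comp_hasDerivAt x (hf.mul hy)

theorem tendsto_pairing (T : A →L[ℝ] ℂ) {f y : ℝ → A} {l : Filter ℝ} (hf : Tendsto f l (𝓝 0))
    {K : ℝ} (hy : ∀ x, ‖y x‖ ≤ K) : Tendsto (fun x => T (f x * y x)) l (𝓝 0) := by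
  have h : Tendsto (fun x => f x * y x) l (𝓝 0) := by
    refine squeeze_zero_norm (a := fun x => ‖f x‖ * K) (fun x => (norm_mul_le _ _).trans
      (mul_le_mul_of_nonneg_left (hy x) (norm_nonneg _))) ?_
    simpa using (tendsto_zero_iff_norm_tendsto_zero.1 hf).mul_const K
  simpa [Function.comp_def] using (T.continuous.tendsto 0).comp h

theorem integral_eq_of_hasDerivAt {p q F : ℝ → ℂ} (hp : Integrable p) (hq : Integrable q)
    (hF : ∀ x, HasDerivAt F (p x - q x) x) (htop : Tendsto F atTop (𝓝 0))
    (hbot : Tendsto F atBot (𝓝 0)) : ∫ x, p x = ∫ x, q x := by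
  have h := integral_of_hasDerivAt_of_tendsto hF (hp.sub hq) hbot htop
  rw [integral_sub hp hq, sub_self] at h
  exact sub_eq_zero.1 h

end Pairing

/-! ### Comparison of the generating loops and of the two integrals -/

section Forms

variable {n : ℕ} {a : Mat n} {γ u g δ δu η : ℝ → Mat n} {J : Set ℤ} {ξ χ : ℝ → Loop n}

/-- The trace as a continuous linear map. -/
noncomputable def traceCLM (n : ℕ) : Mat n →L[ℝ] ℂ :=
  (Matrix.traceLinearMap (Fin n) ℝ ℂ).toContinuousLinearMap

theorem traceCLM_apply (y : Mat n) : traceCLM n y = Matrix.trace y := rfl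

theorem trace_mul_bracket (x y z : Mat n) :
    Matrix.trace (x * ⁅y, z⁆) = -Matrix.trace (⁅x, z⁆ * y) := by
  rw [Ring.lie_def, Ring.lie_def, mul_sub, sub_mul, Matrix.trace_sub, Matrix.trace_sub,
    ← mul_assoc x y z, Matrix.trace_mul_comm (x * y) z, ← mul_assoc x z y, ← mul_assoc z x y]
  ring

theorem trace_bracket_mul (x y z : Mat n) :
    Matrix.trace (⁅x, y⁆ * z) = -Matrix.trace (y * ⁅x, z⁆) := by
  rw [Ring.lie_def, Ring.lie_def, mul_sub, sub_mul, Matrix.trace_sub, Matrix.trace_sub,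
    mul_assoc x y z, Matrix.trace_mul_comm x (y * z), mul_assoc y z x, mul_assoc y x z]
  ring

/-- For `k ≤ 1`, the loops which generate `δγ` and `δu` have the same coefficients up to
fields in the centralizer of `a`. -/
theorem IsVariation.commute_of_nonpos (ha : a.IsDiag) (hg : IsGauge a γ u g)
    (hη : IsVariation a u g δ δu η) {k : ℤ} (hk : k ≤ 0) (hξ : GeneratesPath (k - 2) γ δ ξ)
    (hχ : GeneratesU a k u δu χ) (x : ℝ) : ⁅χ x (k - 1) - pull g ξ (k - 1) x, a⁆ = 0 := by
  rw [generatesPath_iff_of_nonpos (by omega)] at hξ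
  rw [generatesU_iff_of_nonpos hk] at hχ
  obtain ⟨hξd, hξ0, hξs⟩ := hξ
  obtain ⟨hχd, hχ0, hχs⟩ := hχ
  -- Descending induction: equal brackets with `a` in power `j` force `χ_j = ζ_j`, where `ζ = g⁻¹ ξ
  -- g`, and applying `D` then gives equal brackets in power `j - 1`. At the last power, `k - 1`,
  -- only the brackets are known to agree.
  have hind : ∀ m : ℕ, k ≤ -(m : ℤ) → ∀ x,
      ⁅χ x (-(m : ℤ) - 1), a⁆ = ⁅pull g ξ (-(m : ℤ) - 1) x, a⁆ := by
    intro m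
    induction m with
    | zero =>
      intro _ x
      rw [Nat.cast_zero, neg_zero, zero_sub, ← hχ0,
        hη.eq_bracket ha hg hξd hξ0 (hξs 0 (by omega) le_rfl)]
    | succ m ih =>
      intro hm
      have e : -((m + 1 : ℕ) : ℤ) = -(m : ℤ) - 1 := by push_cast; ring
      rw [e] at hm ⊢
      set j : ℤ := -(m : ℤ) - 1
      have h1 : ∀ x, HasDerivAt (fun y => χ y j) (⁅χ x (j - 1), a⁆ - ⁅u x, χ x j⁆) x := fun x =>
        hχd.step (hχs j hm (by omega) x)
      have h2 := hg.pull_step hξd (hξs j (by omega) (by omega))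
      have h3 : ∀ x, χ x j = pull g ξ j x :=
        hg.eq_of_commute ha h1 h2 (fun _ => OffDiag.of_bracket ha _)
          (fun _ => OffDiag.of_bracket ha _) (ih (by omega)) (hχd.2.2.2.2 j).2
          (hg.pull_tendsto hξd j).2
      exact hasDerivAt_of_eq h3 h1 h2
  have h := hind (-k).toNat (by omega) x
  rw [show -((-k).toNat : ℤ) - 1 = k - 1 by omega] at h
  rw [bracket_sub_left, h, sub_self]

/-- For `k ≥ 2`, the loops which generate `δu` and `δγ` have the same coefficients up to
fields in the centralizer of `a`. -/
theorem IsVariation.bracket_eq_of_two_le (hg : IsGauge a γ u g)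
    (hη : IsVariation a u g δ δu η) {k : ℤ} (hk : 2 ≤ k) (hξ : GeneratesPath (k - 2) γ δ ξ)
    (hχ : GeneratesU a k u δu χ) (x : ℝ) : ⁅pull g ξ (k - 2) x, a⁆ = ⁅χ x (k - 2), a⁆ := by
  rw [generatesU_iff_of_pos (by omega)] at hχ
  obtain ⟨hχd, hχ0, hχs⟩ := hχ
  have hz := hη.eq_zeroth hg hχd hχ0
  rcases hk.eq_or_lt with rfl | hk3
  · rw [generatesPath_iff_of_nonpos (by omega)] at hξ
    rw [sub_self, hη.pull_zero_bracket hg hξ.2.1, hz]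
  · rw [generatesPath_iff_of_pos (by omega)] at hξ
    obtain ⟨hξd, hξ0, hξs⟩ := hξ
    -- Ascending induction from `Dζ_1 = [η, a] = Dχ_1`: equal coefficients in one power give equal
    -- `D`-derivatives in the next, and decay at `-∞` fixes the solution.
    have hind : ∀ m : ℕ, (m : ℤ) + 1 ≤ k - 2 → ∀ x,
        pull g ξ ((m : ℤ) + 1) x = χ x ((m : ℤ) + 1) := by
      intro m
      induction m with
      | zero =>
        intro hm
        rw [Nat.cast_zero, zero_add]
        refine hg.eq_of_parallel (w := fun x => ⁅η x, a⁆) (fun x => ?_) (fun x => ?_)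
          (hg.pull_tendsto hξd 1).2 (hχd.2.2.2.2 1).2
        · refine (hg.pull_hasDerivAt (hξd.hasDerivAt 1 x)).congr_deriv ?_
          rw [← hξ0, hη.pull_eq hg]
          rfl
        · refine hχd.step ?_
          rw [← hχs 1 one_pos (by omega) x, sub_self, hz]
      | succ m ih =>
        intro hm
        rw [Nat.cast_succ] at hm ⊢
        have ih' := ih (by omega)
        refine hg.eq_of_parallel (w := fun x => ⁅χ x ((m : ℤ) + 1), a⁆) (fun x => ?_) (fun x => ?_)
          (hg.pull_tendsto hξd _).2 (hχd.2.2.2.2 _).2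
        · have := hg.pull_step hξd (hξs ((m : ℤ) + 1 + 1) (by omega) hm) x
          rwa [add_sub_cancel_right, ih'] at this
        · refine hχd.step ?_
          rw [← hχs ((m : ℤ) + 1 + 1) (by omega) (by omega) x, add_sub_cancel_right]
    have h := hind (k - 3).toNat (by omega) x
    rw [show ((k - 3).toNat : ℤ) + 1 = k - 2 by omega] at h
    rw [h]

/-- The field `β` which compares the two symplectic forms. -/
theorem IsVariation.exists_comparison (ha : a.IsDiag) (hg : IsGauge a γ u g)
    (hη : IsVariation a u g δ δu η) {k : ℤ} (hξ : GeneratesPath (k - 2) γ δ ξ)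
    (hχ : GeneratesU a k u δu χ) : ∃ β : ℝ → Mat n,
      (∀ x, HasDerivAt β (⁅pull g ξ (k - 2) x, a⁆ - ⁅u x, β x⁆) x) ∧
      Tendsto β atTop (𝓝 0) ∧ Tendsto β atBot (𝓝 0) ∧
      ∀ x, ⁅χ x (k - 1) - β x, a⁆ = 0 := by
  -- The field is taken from the loop whose recursion includes the power `k - 1`: that is `ξ` for `k
  -- ≤ 1` and `χ` for `k ≥ 2`.
  rcases le_or_gt k 1 with hk | hk
  · have hξ' := (generatesPath_iff_of_nonpos (by omega)).1 hξ
    obtain ⟨hξd, hξ0, hξs⟩ := hξ'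
    refine ⟨pull g ξ (k - 1), fun x => ?_, (hg.pull_tendsto hξd _).1, (hg.pull_tendsto hξd _).2,
      fun x => ?_⟩
    · have := hg.pull_step hξd (hξs (k - 1) (by omega) (by omega)) x
      rwa [show k - 1 - 1 = k - 2 by ring] at this
    · rcases hk.lt_or_eq with hk0 | rfl
      · exact hη.commute_of_nonpos ha hg (by omega) hξ hχ x
      · rw [generatesU_iff_of_pos one_pos] at hχ
        rw [sub_self, hη.eq_zeroth hg hχ.1 hχ.2.1,
          hη.pull_zero ha hg hξd hξ0 (hξs 0 (by omega) le_rfl), sub_self, zero_bracket]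
  · have hχ' := (generatesU_iff_of_pos (by omega)).1 hχ
    obtain ⟨hχd, hχ0, hχs⟩ := hχ'
    refine ⟨fun x => χ x (k - 1), fun x => ?_, (hχd.2.2.2.2 _).1, (hχd.2.2.2.2 _).2, fun x => ?_⟩
    · refine hχd.step ?_
      rw [hη.bracket_eq_of_two_le hg (by omega) hξ hχ, ← hχs (k - 1) (by omega) (by omega) x,
        show k - 1 - 1 = k - 2 by ring]
    · rw [sub_self, zero_bracket]

/-- The orbit symplectic forms agree. -/
theorem integral_trace_eq (ha : a.IsDiag) (hg : IsGauge a γ u g)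
    (hη : IsVariation a u g δ δu η) {δ₂ δu₂ η₂ : ℝ → Mat n}
    (hη₂ : IsVariation a u g δ₂ δu₂ η₂) {k : ℤ} (hξ : GeneratesPath (k - 2) γ δ ξ)
    (hχ : GeneratesU a k u δu χ) (hi : IsIntegrable δ₂) (hi' : IsIntegrable δu₂) :
    ∫ x, Matrix.trace (χ x (k - 1) * δu₂ x) = ∫ x, Matrix.trace (ξ x (k - 2) * δ₂ x) := by
  obtain ⟨β, hβ, hβt, hβb, hβχ⟩ := hη.exists_comparison ha hg hξ hχ
  obtain ⟨K, hK⟩ := hη₂.bounded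
  have hξd : ∃ J, IsDecayingLoop J ξ := hξ.elim (fun h => ⟨_, h.2.1⟩) fun h => ⟨_, h.2.1⟩
  have hχd : ∃ J, IsDecayingLoop J χ := hχ.elim (fun h => ⟨_, h.2.1⟩) fun h => ⟨_, h.2.1⟩
  obtain ⟨_, hξd⟩ := hξd
  obtain ⟨_, hχd⟩ := hχd
  -- Integration by parts: the derivative of `tr(β η₂)` is the difference of the integrands. The
  -- boundary terms vanish because `β` decays at both ends, while `η₂` need only be bounded.
  refine integral_eq_of_hasDerivAt
    (integrable_pairing (traceCLM n) (hχd.2.2.2.1 (k - 1)).continuous (hχd.2.2.2.2 _).1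
      (hχd.2.2.2.2 _).2 hi')
    (integrable_pairing (traceCLM n) (hξd.2.2.2.1 (k - 2)).continuous (hξd.2.2.2.2 _).1
      (hξd.2.2.2.2 _).2 hi)
    (F := fun x => traceCLM n (β x * η₂ x)) (fun x => ?_)
    (tendsto_pairing (traceCLM n) hβt hK) (tendsto_pairing (traceCLM n) hβb hK)
  refine (hasDerivAt_pairing (traceCLM n) (hβ x) (hη₂.hasDerivAt x)).congr_deriv ?_
  have h1 : Matrix.trace (χ x (k - 1) * δu₂ x) = Matrix.trace (β x * δu₂ x) := by
    have := (hη₂.offDiag x).trace_mul ha (hβχ x)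
    rwa [sub_mul, Matrix.trace_sub, sub_eq_zero] at this
  have h2 : Matrix.trace (ξ x (k - 2) * δ₂ x) =
      -Matrix.trace (⁅pull g ξ (k - 2) x, a⁆ * η₂ x) := by
    rw [← trace_mul_bracket, hη₂.conj, pull, mul_assoc (star (g x) * ξ x (k - 2)) (g x),
      mul_assoc (star (g x)), Matrix.trace_mul_comm (star (g x)), mul_assoc (ξ x (k - 2))]
  have h3 := trace_bracket_mul (u x) (β x) (η₂ x)
  refine (traceCLM_apply _).trans ?_
  rw [h1, h2, sub_mul, mul_sub, Matrix.trace_add, Matrix.trace_sub, Matrix.trace_sub, h3]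
  ring

end Forms

/-! ### The frame of a path as a gauge transformation -/

section Main

variable {n : ℕ} {a : Mat n} {γ δ g : ℝ → Mat n}

theorem isGauge_frame (hau : a ∈ uLie n) (ha : a.IsDiag) (hγ : γ ∈ pathSpace a)
    (hg : IsUnitarySolution (frameCoeff a γ) g) : IsGauge a γ (Phi a γ) g := by
  have hΦ := Phi_mem hau ha hγ hg
  refine ⟨fun x => ?_, hg.star_mul_self, hg.mul_star_self, hg.temperate.1, fun x => (hΦ.2 x).1,
    fun x => ((mem_centrPerp_iff ha).1 (hΦ.2 x)).2, path_eq_conj hau ha hγ hg⟩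
  rw [Phi_eq hau ha hγ hg]
  exact frame_hasDerivAt hg x

theorem isVariation_frameVar (hau : a ∈ uLie n) (ha : a.IsDiag) (hγ : γ ∈ pathSpace a)
    (hg : IsUnitarySolution (frameCoeff a γ) g) (hδ : δ ∈ tangentPath a γ) :
    IsVariation a (Phi a γ) g δ (dPhi a γ δ) (frameVar a γ δ g) := by
  have hd := dPhi_eq hau ha hγ hg hδ
  have hm := dPhi_mem hau ha hγ hg hδ
  obtain ⟨c, hc⟩ := hδ
  refine ⟨fun x => ?_, frameVar_tendsto, frameVar_bounded hγ hg hc,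
    velocity_eq_conj hau ha hγ hg hc, fun x => ((mem_centrPerp_iff ha).1 (hm.2 x)).2⟩
  rw [hd, add_sub_cancel_right]
  exact frameVar_hasDerivAt hγ hg hc x

/-- A tangent vector has Schwartz derivative but may have a nonzero limit at `+∞`. A generator of
order `0` excludes this, since `δ = [ξ_0, γ]` with `ξ_0` decaying. -/
theorem integrable_velocity (hau : a ∈ uLie n) (ha : a.IsDiag) (hγ : γ ∈ pathSpace a)
    (hδ : δ ∈ tangentPath a γ) {ξ : ℝ → Loop n} (hξ : GeneratesPath 0 γ δ ξ) : IsIntegrable δ := by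
  obtain ⟨g, hg⟩ := exists_path_frame hau ha hγ
  have hG := isGauge_frame hau ha hγ hg
  have hη := isVariation_frameVar hau ha hγ hg hδ
  obtain ⟨K, hK, hK'⟩ := hG.exists_bound
  obtain ⟨c, hc⟩ := hδ
  have hξ' := (generatesPath_iff_of_nonpos le_rfl).1 hξ
  have hlim : ∀ {l : Filter ℝ}, Tendsto (pull g ξ 0) l (𝓝 0) → Tendsto δ l (𝓝 0) := by
    intro l hl
    have h1 : Tendsto (fun x => ⁅pull g ξ 0 x, a⁆) l (𝓝 0) := by
      simpa [Ring.lie_def] using (hl.mul_const a).sub (hl.const_mul a)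
    rw [show δ = _ from funext hη.conj]
    simp only [← hη.pull_zero_bracket hG hξ'.2.1]
    exact tendsto_conj_zero hK hK' h1
  exact integrable_of_rapid_deriv
    (fun x => (velocity_hasDerivAt hc x).differentiableAt.hasDerivAt) (velocity_deriv_rapid hc)
    (hlim (hG.pull_tendsto hξ'.1 0).2) (hlim (hG.pull_tendsto hξ'.1 0).1)

end Main

end Development

theorem theorem5p3 {n : ℕ} (a : Development.Mat n) (ha : a ∈ Development.uLie n)
    (hdiag : a.IsDiag) (k : ℤ) (γ : ℝ → Development.Mat n)
    (hγ : γ ∈ Development.pathSpace a) :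
    -- `dΦ_γ` is the differential of `Φ` at `γ`, along every curve
    (∀ δ ∈ Development.tangentPath a γ, ∀ c, Development.Represents a γ δ c →
      Development.HasVelocity (fun s => Development.Phi a (c s)) (Development.dPhi a γ δ)) ∧
    -- comparison of the spaces on which the two forms live
    (k ≤ 1 → ∀ δ ∈ Development.tangentM a (k - 2) γ,
      Development.dPhi a γ δ ∈ Development.tangentU a k (Development.Phi a γ)) ∧
    (2 ≤ k → ∀ δ ∈ Development.tangentPath a γ,
      Development.dPhi a γ δ ∈ Development.tangentU a k (Development.Phi a γ) →
        δ ∈ Development.tangentM a (k - 2) γ) ∧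
    -- `Φ^*(w_k) = τ_{k-2}`
    (∀ δ₁ ∈ Development.tangentM a (k - 2) γ, ∀ δ₂ ∈ Development.tangentM a (k - 2) γ,
      Development.dPhi a γ δ₁ ∈ Development.tangentU a k (Development.Phi a γ) →
      Development.dPhi a γ δ₂ ∈ Development.tangentU a k (Development.Phi a γ) →
      Development.wForm a k (Development.Phi a γ)
          (Development.dPhi a γ δ₁) (Development.dPhi a γ δ₂) =
        Development.tauForm (k - 2) γ δ₁ δ₂) := by
  obtain ⟨g, hg⟩ := Development.exists_path_frame ha hdiag hγ
  have hG := Development.isGauge_frame ha hdiag hγ hg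
  have hvar : ∀ δ ∈ Development.tangentPath a γ, Development.IsVariation a (Development.Phi a γ) g
      δ (Development.dPhi a γ δ) (Development.frameVar a γ δ g) := fun δ hδ =>
    Development.isVariation_frameVar ha hdiag hγ hg hδ
  have hmem : ∀ δ ∈ Development.tangentPath a γ,
      Development.dPhi a γ δ ∈ Development.schwartzPerp a := fun δ hδ =>
    Development.dPhi_mem ha hdiag hγ hg hδ
  refine ⟨fun δ hδ c hc x => ?_, fun hk δ hδ => ?_, fun hk δ hδ hu => ?_,
    fun δ₁ h₁ δ₂ h₂ hu₁ hu₂ => ?_⟩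
  · rw [Development.dPhi_eq ha hdiag hγ hg hδ]
    exact Development.Phi_hasDerivAt ha hdiag hγ hg hc x
  · obtain ⟨hδ, -, ξ, hξ⟩ := hδ
    exact ⟨hmem δ hδ,
      (hvar δ hδ).generatesU hdiag hG hk zero_le_one (Or.inr rfl) hξ,
      (hvar δ hδ).generatesU hdiag hG hk hk (Or.inl le_rfl) hξ⟩
  · obtain ⟨-, -, χ, hχ⟩ := hu
    exact ⟨hδ, (hvar δ hδ).generatesPath hG (by omega) le_rfl (Or.inr rfl) hχ,
      (hvar δ hδ).generatesPath hG (by omega) (by omega) (Or.inl (by omega)) hχ⟩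
  · obtain ⟨hδ₁, -, hξ⟩ := h₁
    -- The order-`0` generator of the second vector serves to make that vector integrable.
    obtain ⟨hδ₂, ⟨ζ, hζ⟩, -⟩ := h₂
    obtain ⟨-, -, hχ⟩ := hu₁
    -- The generators picked by choice in the two forms are unrelated, but the comparison of the
    -- integrals holds for any pair of generators.
    rw [Development.wForm, dif_pos hχ, Development.tauForm, dif_pos hξ]
    simp only [Development.loopForm_neg_one, Development.loopForm_one]
    exact Development.integral_trace_eq hdiag hG (hvar δ₁ hδ₁) (hvar δ₂ hδ₂) hξ.choose_spec
      hχ.choose_spec (Development.integrable_velocity ha hdiag hγ hδ₂ hζ)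
      (Development.isRapid_iff.2 (hmem δ₂ hδ₂).1).integrable
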